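/- Let $n\ge 3$ and let $a,b,c\in\mathbb{C}[s,v]$ be homogeneous polynomials of degree $n$ with $\gcd(a,b,c)=1$ such that $\phi=(a:b:c):\mathbb{P}^1_{\mathbb C}\to\mathbb{P}^2_{\mathbb C}$ is birational onto its image. A $\mu$-basis of $\phi$ is a basis $\{p,q\}$ of the free $\mathbb{C}[s,v]$-module of syzygies $\{(g_1,g_2,g_3): g_1a+g_2b+g_3c=0\}$ in which $p=(p_1,p_2,p_3)$ and $q=(q_1,q_2,q_3)$ are homogeneous of degrees $\mu\le n-\mu$ respectively. Put $$p_\phi(s,v;t,u)=p_1(s,v)a(t,u)+p_2(s,v)b(t,u)+p_3(s,v)c(t,u),\qquad q_\phi(s,v;t,u)=q_1(s,v)a(t,u)+q_2(s,v)b(t,u)+q_3(s,v)c(t,u).$$ Hybrid matrices. Let $R$ be a commutative ring, $N\ge m\ge 0$, and let $f=\sum_{i=0}^{N}a_ix^i$, $g=\sum_{i=0}^m b_ix^i$ be in $R[x]$. For $0\le k\le m-1$ let $f_k=a_Nx^{N-m+k}+a_{N-1}x^{N-m+k-1}+\dots+a_{m-k}$, $g_k=b_mx^k+b_{m-1}x^{k-1}+\dots+b_{m-k}$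 and $h_k=g_kf-f_kg$ (a polynomial of degree at most $N-1$). For $0\le j\le m$ let $\psi_j(f,g)$ be the square matrix of size $m+N-j$, in the monomial bases, of the $R$-linear map $$R^j\oplus R[x]_{\le m-j-1}\oplus R[x]_{\le N-j-1}\to R[x]_{\le m+N-j-1},\qquad (e_i,\alpha,\beta)\mapsto h_{m-j+i-1}+\alpha f+\beta g .$$ For a $\mu$-basis $\{p,q\}$ and $0\le j\le\mu$, let $\psi_j(p_\phi,q_\phi)$ be the $(n-j)\times(n-j)$ matrix over $R=\mathbb{C}[t,u]$ obtained with $x=s$, $f=q_\phi(s,1;t,u)$, $N=n-\mu$, $g=p_\phi(s,1;t,u)$, $m=\mu$. (So $\psi_0$ is the Sylvester matrix and $\psi_\mu$ the hybrid Bézout matrix.) A collection of singular factors of an $r\times r$ matrix over $\mathbb{C}[t,u]$ is a sequence of homogeneous polynomials $d_1,\dots,d_r\in\mathbb{C}[t,u]$ such that for each $i=1,\dots,r$ the product $d_r^{\,r-i+1}d_{r-1}^{\,r-i}\cdots d_{i+1}^{\,2}d_i$ is a greatest common divisor of the $(r+1-i)$-minors of the matrix. Claim. The singular factors of the matrices $\psi_j(p_\phi,q_\phi)$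 exist, are unique up to nonzero constants, and depend neither on $j$ nor on the $\mu$-basis. Precisely: there are polynomials $d_1,\dots,d_n\in\mathbb{C}[t,u]$, depending only on $\phi$, such that for every $\mu$-basis $\{p,q\}$ of $\phi$ (with $\mu=\deg p$), $d_i$ is a nonzero constant for $n-\mu<i\le n$, and for every $j\in\{0,\dots,\mu\}$ a sequence $e_1,\dots,e_{n-j}\in\mathbb{C}[t,u]$ is a collection of singular factors of $\psi_j(p_\phi,q_\phi)$ if and only if, for each $i=1,\dots,n-j$, $e_i$ equals $d_i$ up to a nonzero constant factor. -/

import Mathlib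

open scoped Polynomial

noncomputable section

namespace HybridResultant

/-- The ring `ℂ[s,v]` (equally `ℂ[t,u]`): the variable with index `0` is `s` (or `t`), the variable
with index `1` is `v` (or `u`). -/
abbrev Forms : Type := MvPolynomial (Fin 2) ℂ

/-- `φ = (a, b, c)` is a triple of homogeneous polynomials of the same degree `n` without common
factor that parameterizes a plane curve birationally onto its image. Birationality is the existence
of a rational inverse `(x₁ : x₂ : x₃) ↦ (A(x) : B(x))`, given by two forms of the same
degree that do not both vanish on the curve, with `(A(φ(s,v)) : B(φ(s,v))) = (s : v)`. -/
structure IsProperParam (n : ℕ) (φ : Fin 3 → Forms) : Prop where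
  homogeneous : ∀ i, (φ i).IsHomogeneous n
  coprime : ∀ h : Forms, (∀ i, h ∣ φ i) → IsUnit h
  birational : ∃ (e : ℕ) (A B : MvPolynomial (Fin 3) ℂ), A.IsHomogeneous e ∧ B.IsHomogeneous e ∧
    ¬ (MvPolynomial.aeval φ A = 0 ∧ MvPolynomial.aeval φ B = 0) ∧
    MvPolynomial.X 1 * MvPolynomial.aeval φ A = MvPolynomial.X 0 * MvPolynomial.aeval φ B

/-- The module of syzygies of `(a, b, c)`. -/
def syzygies (φ : Fin 3 → Forms) : Submodule Forms (Fin 3 → Forms) where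
  carrier := {g | ∑ i, g i * φ i = 0}
  zero_mem' := by simp
  add_mem' := by
    intro x y hx hy
    simp only [Set.mem_ofPred_eq] at hx hy
    simp [add_mul, Finset.sum_add_distrib, hx, hy]
  smul_mem' := by
    intro r x hx
    simp only [Set.mem_ofPred_eq] at hx
    simp [mul_assoc, ← Finset.mul_sum, hx]

/-- `{p, q}` is a `μ`-basis of `φ` : a basis of the syzygy module, homogeneous of degrees
`μ ≤ n - μ`. -/
structure IsMuBasis (n : ℕ) (φ : Fin 3 → Forms) (μ : ℕ) (p q : Fin 3 → Forms) : Prop where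
  le : μ ≤ n - μ
  homogeneous_left : ∀ i, (p i).IsHomogeneous μ
  homogeneous_right : ∀ i, (q i).IsHomogeneous (n - μ)
  linearIndependent : LinearIndependent Forms ![p, q]
  span_eq : Submodule.span Forms {p, q} = syzygies φ

/-- The form `∑ᵢ gᵢ(s,v) φᵢ(t,u)`, written at `v = 1` as a polynomial in `s` with coefficients in
`ℂ[t,u]`. If the `gᵢ` are homogeneous of degree `d`, its coefficient of `s ^ l` is the
coefficient of `s ^ l * v ^ (d - l)` of the form. -/
def substForm (φ g : Fin 3 → Forms) : Forms[X] :=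
  ∑ i, MvPolynomial.aeval ![(Polynomial.X : Forms[X]), 1] (g i) * Polynomial.C (φ i)

section Hybrid

variable {R : Type*} [CommRing R]

/-- For `f = a₀ + ⋯ + aₙ tⁿ` and `0 ≤ e ≤ n`: the polynomial
`aₙ t ^ (n - e) + aₙ₋₁ t ^ (n - e - 1) + ⋯ + aₑ`. -/
def upperPart (n e : ℕ) (f : R[X]) : R[X] :=
  ∑ l ∈ Finset.range (n - e + 1), Polynomial.C (f.coeff (e + l)) * Polynomial.X ^ l

/-- The polynomial `p_k = g_k f - f_k g`, where `f_k = aₙ t ^ (n - m + k) + ⋯ + a_{m - k}` and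
`g_k = bₘ t ^ k + ⋯ + b_{m - k}`, for `k < m ≤ n`. -/
def bezoutPoly (n m : ℕ) (f g : R[X]) (k : ℕ) : R[X] :=
  upperPart m (m - k) g * f - upperPart n (m - k) f * g

/-- The images of the canonical basis vectors of `R ^ j ⊕ R[t]_{≤ m - j - 1} ⊕ R[t]_{≤ n - j - 1}`
under `ψ_j : (eᵢ, a, b) ↦ p_{m - j + i - 1} + a f + b g`, `i = 1, …, j` (here `i` is
counted from `0`). -/
def hybridColumn (n m j : ℕ) (f g : R[X]) : Fin j ⊕ (Fin (m - j) ⊕ Fin (n - j)) → R[X]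
  | Sum.inl i => bezoutPoly n m f g (m - j + i)
  | Sum.inr (Sum.inl l) => Polynomial.X ^ (l : ℕ) * f
  | Sum.inr (Sum.inr l) => Polynomial.X ^ (l : ℕ) * g

/-- The matrix of `ψ_j` in the monomial bases, for polynomials `f`, `g` of degrees at most
`n`, `m`, with `j ≤ m ≤ n`. The target is `R[t]_{≤ m + n - j - 1}`; the matrix has as
many columns as rows. -/
def hybridMatrix (n m j : ℕ) (f g : R[X]) :
    Matrix (Fin (m + n - j)) (Fin j ⊕ (Fin (m - j) ⊕ Fin (n - j))) R :=
  Matrix.of fun r c => (hybridColumn n m j f g c).coeff r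

/-- The `k × k` minors of a matrix (each of them up to sign). -/
def minors {r c : Type*} (M : Matrix r c R) (k : ℕ) : Set R :=
  {x | ∃ (f : Fin k ↪ r) (g : Fin k ↪ c), x = (M.submatrix f g).det}

/-- `x` is a greatest common divisor of the elements of `S`. -/
def IsGCDOf (S : Set R) (x : R) : Prop :=
  (∀ y ∈ S, x ∣ y) ∧ ∀ z, (∀ y ∈ S, z ∣ y) → z ∣ x

end Hybrid

/-- `d 1, …, d N` is a collection of singular factors of a matrix `M` with `N` rows (and as many
columns) over `ℂ[t,u]` : these polynomials are homogeneous, and for `i = 1, …, N` the product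
`d_N ^ (N - i + 1) ⋯ d_{i + 1} ^ 2 d_i` is a greatest common divisor of the
`(N + 1 - i)`-minors of `M`. The other values of `d` are not used. -/
def IsSingularFactors {N : ℕ} {c : Type*} (M : Matrix (Fin N) c Forms) (d : ℕ → Forms) : Prop :=
  ∀ i, 1 ≤ i → i ≤ N →
    (∃ e, (d i).IsHomogeneous e) ∧
    IsGCDOf (minors M (N + 1 - i)) (∏ k ∈ Finset.Icc i N, d k ^ (k - i + 1))

/-- The hybrid matrix `ψ_j(p_φ, q_φ)` of a `μ`-basis `{p, q}`: the polynomial of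
degree `n - μ` is `q_φ`, the one of degree `μ` is `p_φ`. -/
def psi (n : ℕ) (φ : Fin 3 → Forms) (μ : ℕ) (p q : Fin 3 → Forms) (j : ℕ) :
    Matrix (Fin (μ + (n - μ) - j)) (Fin j ⊕ (Fin (μ - j) ⊕ Fin (n - μ - j))) Forms :=
  hybridMatrix (n - μ) μ j (substForm φ q) (substForm φ p)

end HybridResultant

end

/-! Let `G k` be the gcd of the `k`-minors of the Sylvester matrix ψ_0. The heart of the matter is
that the gcd of the `k`-minors of ψ_j is `G (k + j)` for every `j` and every μ-basis
(`exists_isGCDOf_minors_psi`).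

Gcds in the factorial ring ℂ[t,u] can be compared after localizing at each prime element π; there
divisibility is total and an ideal of minors is generated by the gcd (`span_image_atPrime`).
Locally, ψ_j and 1 ⊕ ψ_{j+1} have the same ideals of minors as soon as some c ∈ ℂ makes p_φ(c,1;t,u)
or q_φ(c,1;t,u) prime to π: the image of ψ_j is then spanned by (X - c) · im ψ_{j+1} and one
polynomial with value 1 at c (`minorIdeal_hybridMatrix_succ`). Such a c exists: otherwise the Koszul
syzygies would make φ(c,1) proportional to φ modulo π for all c, and φ would be constant
(`IsMuBasis.exists_not_dvd`). The image of ψ_0 is spanned by the polynomials attached to the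
syzygies of degree n - 1, so it depends on φ alone (`IsMuBasis.minorIdeal_psi_zero_eq`).

Diagonalizing over the local rings gives G(k+1)² ∣ G(k+2) G(k) (`sq_dvd_mul_of_isGCDOf_minors`), and
these quotients are the singular factors. They are found, and shown unique, by cancellation, which
needs G(k) ≠ 0 for k < n. By birationality p_φ and q_φ have the single common root t/u over the
fraction field, so ψ_0 has rank exactly n - 1 (`IsMuBasis.minorIdeal_sylvester`); in particular d_1
= 0. Finally G(j) is the gcd of the empty minor of ψ_j, hence a unit for j ≤ μ, so that d_i is
constant for i > n - μ. -/

noncomputable section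

namespace HybridResultant

/-! ### Ideals of minors, and diagonalization over a valuation ring. -/

section MinorIdeal

variable {A : Type*} [CommRing A]

/-- The ideal generated by the `k × k` minors of a matrix. -/
def minorIdeal {r c : Type*} (M : Matrix r c A) (k : ℕ) : Ideal A := Ideal.span (minors M k)

theorem det_submatrix_mem_minorIdeal {r c : Type*} (M : Matrix r c A) {k : ℕ}
    (f : Fin k → r) (g : Fin k → c) : (M.submatrix f g).det ∈ minorIdeal M k := by
  by_cases hf : Function.Injective f
  · by_cases hg : Function.Injective g
    · exact Ideal.subset_span ⟨⟨f, hf⟩, ⟨g, hg⟩, rfl⟩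
    · obtain ⟨a, b, hab, hne⟩ := Function.not_injective_iff.1 hg
      rw [Matrix.det_zero_of_column_eq hne (fun i => by simp [hab])]
      exact zero_mem _
  · obtain ⟨a, b, hab, hne⟩ := Function.not_injective_iff.1 hf
    rw [Matrix.det_zero_of_row_eq hne (by ext i; simp [hab])]
    exact zero_mem _

theorem minorIdeal_le {r c : Type*} {M : Matrix r c A} {k : ℕ} {I : Ideal A}
    (h : ∀ (f : Fin k ↪ r) (g : Fin k ↪ c), (M.submatrix f g).det ∈ I) : minorIdeal M k ≤ I := by
  refine Ideal.span_le.2 ?_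
  rintro _ ⟨f, g, rfl⟩
  exact h f g

theorem minorIdeal_zero {r c : Type*} (M : Matrix r c A) : minorIdeal M 0 = ⊤ := by
  rw [Ideal.eq_top_iff_one]
  simpa using det_submatrix_mem_minorIdeal M (Fin.elim0 : Fin 0 → r) (Fin.elim0 : Fin 0 → c)

theorem minorIdeal_transpose {r c : Type*} (M : Matrix r c A) (k : ℕ) :
    minorIdeal M.transpose k = minorIdeal M k := by
  apply le_antisymm <;> refine minorIdeal_le fun f g => ?_
  · rw [← Matrix.det_transpose]
    exact det_submatrix_mem_minorIdeal M g f
  · rw [← Matrix.det_transpose]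
    exact det_submatrix_mem_minorIdeal M.transpose g f

theorem minorIdeal_submatrix_le {r c r' c' : Type*} (M : Matrix r c A) (e : r' → r) (e' : c' → c)
    (k : ℕ) : minorIdeal (M.submatrix e e') k ≤ minorIdeal M k :=
  minorIdeal_le fun f g => det_submatrix_mem_minorIdeal M (e ∘ f) (e' ∘ g)

theorem minorIdeal_submatrix_equiv {r c r' c' : Type*} (M : Matrix r c A) (e : r' ≃ r)
    (e' : c' ≃ c) (k : ℕ) : minorIdeal (M.submatrix e e') k = minorIdeal M k := by
  refine le_antisymm (minorIdeal_submatrix_le M e e' k) ?_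
  have := minorIdeal_submatrix_le (M.submatrix e e') e.symm e'.symm k
  simpa using this

/-- The columns of a product are combinations of the columns of `M`; expanding the determinant
multilinearly in its columns gives the weak half of Cauchy–Binet that suffices here. -/
theorem minorIdeal_mul_le_left {r l c : Type*} [Fintype l] (M : Matrix r l A) (N : Matrix l c A)
    (k : ℕ) : minorIdeal (M * N) k ≤ minorIdeal M k := by
  classical
  refine minorIdeal_le fun f g => ?_
  have h : ((M * N).submatrix f g).det = (((M * N).submatrix f g).transpose).det :=
    (Matrix.det_transpose _).symm
  have h2 : ((M * N).submatrix f g).transpose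
      = fun i : Fin k => ∑ x : l, N x (g i) • (fun a : Fin k => M (f a) x) := by
    funext i a
    simp [Matrix.mul_apply, mul_comm]
  rw [h, h2]
  change Matrix.detRowAlternating.toMultilinearMap _ ∈ _
  rw [MultilinearMap.map_sum]
  refine Ideal.sum_mem _ fun s _ => ?_
  rw [MultilinearMap.map_smul_univ]
  refine Ideal.mul_mem_left _ _ ?_
  have := det_submatrix_mem_minorIdeal M f s
  rw [← Matrix.det_transpose] at this
  exact this

theorem minorIdeal_mul_le_right {r l c : Type*} [Fintype l] (M : Matrix r l A) (N : Matrix l c A)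
    (k : ℕ) : minorIdeal (M * N) k ≤ minorIdeal N k := by
  rw [← minorIdeal_transpose, Matrix.transpose_mul, ← minorIdeal_transpose N]
  exact minorIdeal_mul_le_left _ _ _

theorem minorIdeal_succ_le {r c : Type*} (M : Matrix r c A) (k : ℕ) :
    minorIdeal M (k + 1) ≤ minorIdeal M k := by
  refine minorIdeal_le fun f g => ?_
  rw [Matrix.det_succ_row_zero]
  refine Ideal.sum_mem _ fun i _ => Ideal.mul_mem_left _ _ ?_
  exact det_submatrix_mem_minorIdeal M (f ∘ Fin.succ) (g ∘ i.succAbove)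

theorem minorIdeal_smul {r c : Type*} (a : A) (M : Matrix r c A) (k : ℕ) :
    minorIdeal (a • M) k = Ideal.span {a ^ k} * minorIdeal M k := by
  have key (f : Fin k → r) (g : Fin k → c) :
      ((a • M).submatrix f g).det = a ^ k * (M.submatrix f g).det := by
    have h : (a • M).submatrix f g = a • M.submatrix f g := rfl
    rw [h, Matrix.det_smul, Fintype.card_fin]
  apply le_antisymm
  · refine minorIdeal_le fun f g => ?_
    rw [key]
    exact Ideal.mul_mem_mul (Ideal.mem_span_singleton_self _) (det_submatrix_mem_minorIdeal M f g)
  · unfold minorIdeal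
    rw [Ideal.span_mul_span', Ideal.span_le]
    rintro _ ⟨_, rfl, _, ⟨f, g, rfl⟩, rfl⟩
    change a ^ k * _ ∈ _
    rw [← key]
    exact det_submatrix_mem_minorIdeal (a • M) f g

theorem minorIdeal_map {B : Type*} [CommRing B] {r c : Type*} (M : Matrix r c A) (φ : A →+* B)
    (k : ℕ) : minorIdeal (M.map φ) k = Ideal.span (φ '' minors M k) := by
  unfold minorIdeal
  congr 1
  ext x
  constructor
  · rintro ⟨f, g, rfl⟩
    exact ⟨_, ⟨f, g, rfl⟩, by rw [RingHom.map_det]; rfl⟩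
  · rintro ⟨_, ⟨f, g, rfl⟩, rfl⟩
    exact ⟨f, g, by rw [RingHom.map_det]; rfl⟩

/-- A minor through the pivot row expands along that row; one that avoids the pivot row is zero or a
larger minor of `M`, which lies in the ideal of the smaller ones. -/
theorem minorIdeal_one_block {r c : Type*} [DecidableEq r] [DecidableEq c] (M : Matrix r c A)
    (k : ℕ) :
    minorIdeal (Matrix.fromBlocks (1 : Matrix Unit Unit A) 0 0 M) (k + 1) = minorIdeal M k := by
  apply le_antisymm
  · refine minorIdeal_le fun f g => ?_
    by_cases hf : ∃ a, f a = Sum.inl ()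
    · obtain ⟨a, ha⟩ := hf
      rw [Matrix.det_succ_row _ a]
      refine Ideal.sum_mem _ fun b _ => Ideal.mul_mem_left _ _ ?_
      have h1 : ∀ i, ∃ i', f (a.succAbove i) = Sum.inr i' := fun i => by
        rcases h : f (a.succAbove i) with x | x
        · have : f (a.succAbove i) = f a := by rw [h, ha]
          exact absurd (f.injective this) (Fin.succAbove_ne a i)
        · exact ⟨x, rfl⟩
      choose f' hf' using h1
      by_cases hg : ∃ i, g (b.succAbove i) = Sum.inl ()
      · obtain ⟨i, hi⟩ := hg
        rw [Matrix.det_eq_zero_of_column_eq_zero i (fun i' => by simp [hi, hf'])]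
        exact zero_mem _
      · have h2 : ∀ i, ∃ i', g (b.succAbove i) = Sum.inr i' := fun i => by
          rcases h : g (b.succAbove i) with x | x
          · exact absurd ⟨i, h⟩ hg
          · exact ⟨x, rfl⟩
        choose g' hg' using h2
        convert det_submatrix_mem_minorIdeal M f' g' using 2
        ext x y
        simp [hf', hg']
    · have h1 : ∀ i, ∃ i', f i = Sum.inr i' := fun i => by
        rcases h : f i with x | x
        · exact absurd ⟨i, h⟩ hf
        · exact ⟨x, rfl⟩
      choose f' hf' using h1
      by_cases hg : ∃ i, g i = Sum.inl ()
      · obtain ⟨i, hi⟩ := hg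
        rw [Matrix.det_eq_zero_of_column_eq_zero i (fun i' => by simp [hi, hf'])]
        exact zero_mem _
      · have h2 : ∀ i, ∃ i', g i = Sum.inr i' := fun i => by
          rcases h : g i with x | x
          · exact absurd ⟨i, h⟩ hg
          · exact ⟨x, rfl⟩
        choose g' hg' using h2
        refine minorIdeal_succ_le M k ?_
        convert det_submatrix_mem_minorIdeal M f' g' using 2
        ext x y
        simp [hf', hg']
  · refine minorIdeal_le fun f g => ?_
    have := det_submatrix_mem_minorIdeal (Matrix.fromBlocks (1 : Matrix Unit Unit A) 0 0 M)
      (Fin.cons (Sum.inl ()) (Sum.inr ∘ f)) (Fin.cons (Sum.inl ()) (Sum.inr ∘ g))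
    convert this using 1
    rw [Matrix.det_succ_row_zero, Fin.sum_univ_succ, Finset.sum_eq_zero]
    · simp
      congr 1
    · intro i _
      simp

/-- Schur complement: unipotent row and column operations clear `B` and `C`. -/
theorem minorIdeal_fromBlocks_one {r c : Type*} [Fintype r] [Fintype c] [DecidableEq r]
    [DecidableEq c] (B : Matrix Unit c A) (C : Matrix r Unit A) (D : Matrix r c A) (k : ℕ) :
    minorIdeal (Matrix.fromBlocks 1 B C D) (k + 1) = minorIdeal (D - C * B) k := by
  rw [← minorIdeal_one_block (D - C * B)]
  have key : Matrix.fromBlocks 1 B C D =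
      (Matrix.fromBlocks 1 0 C 1 : Matrix (Unit ⊕ r) (Unit ⊕ r) A) *
      Matrix.fromBlocks (1 : Matrix Unit Unit A) 0 0 (D - C * B) *
      (Matrix.fromBlocks 1 B 0 1 : Matrix (Unit ⊕ c) (Unit ⊕ c) A) := by
    simp [Matrix.fromBlocks_multiply]
  have key' : Matrix.fromBlocks (1 : Matrix Unit Unit A) 0 0 (D - C * B) =
      (Matrix.fromBlocks 1 0 (-C) 1 : Matrix (Unit ⊕ r) (Unit ⊕ r) A) *
      Matrix.fromBlocks 1 B C D *
      (Matrix.fromBlocks 1 (-B) 0 1 : Matrix (Unit ⊕ c) (Unit ⊕ c) A) := by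
    simp [Matrix.fromBlocks_multiply, sub_eq_neg_add]
  apply le_antisymm
  · rw [key]
    exact (minorIdeal_mul_le_left _ _ _).trans (minorIdeal_mul_le_right _ _ _)
  · rw [key']
    exact (minorIdeal_mul_le_left _ _ _).trans (minorIdeal_mul_le_right _ _ _)

theorem exists_pivot {r c : Type*} [Fintype r] [Fintype c] [DecidableEq r] [DecidableEq c]
    (M : Matrix r c A) (i₀ : r) (j₀ : c) (h : M i₀ j₀ = 1) :
    ∃ M' : Matrix {i // i ≠ i₀} {j // j ≠ j₀} A,
      ∀ k, minorIdeal M (k + 1) = minorIdeal M' k := by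
  let e : Unit ⊕ {i // i ≠ i₀} ≃ r :=
    (Equiv.sumCongr (Equiv.ofUnique Unit {i // i = i₀}) (Equiv.refl _)).trans
      (Equiv.sumCompl (· = i₀))
  let e' : Unit ⊕ {j // j ≠ j₀} ≃ c :=
    (Equiv.sumCongr (Equiv.ofUnique Unit {j // j = j₀}) (Equiv.refl _)).trans
      (Equiv.sumCompl (· = j₀))
  set M₁ := M.submatrix e e' with hM₁
  have h11 : M₁.toBlocks₁₁ = 1 := by
    ext x y
    change M (default : {i // i = i₀}) (default : {j // j = j₀}) = (1 : Matrix Unit Unit A) x y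
    rw [(default : {i // i = i₀}).2, (default : {j // j = j₀}).2, h, Subsingleton.elim x y,
      Matrix.one_apply_eq]
  refine ⟨M₁.toBlocks₂₂ - M₁.toBlocks₂₁ * M₁.toBlocks₁₂, fun k => ?_⟩
  rw [← minorIdeal_fromBlocks_one, ← h11, Matrix.fromBlocks_toBlocks, hM₁,
    minorIdeal_submatrix_equiv]

theorem exists_dvd_all {ι : Type*} (hA : ∀ a b : A, a ∣ b ∨ b ∣ a) (s : Finset ι)
    (hs : s.Nonempty) (f : ι → A) : ∃ i ∈ s, ∀ j ∈ s, f i ∣ f j := by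
  classical
  induction hs using Finset.Nonempty.cons_induction with
  | singleton a => exact ⟨a, by simp⟩
  | cons a s ha hs ih =>
    obtain ⟨i, hi, h⟩ := ih
    rcases hA (f a) (f i) with h1 | h1
    · exact ⟨a, by simp, fun j hj => by
        rcases Finset.mem_cons.1 hj with rfl | hj
        · rfl
        · exact h1.trans (h j hj)⟩
    · exact ⟨i, by simp [hi], fun j hj => by
        rcases Finset.mem_cons.1 hj with rfl | hj
        · exact h1
        · exact h j hj⟩

/-- Over a valuation ring the ideals of minors of a matrix are generated by products of the form
`a₀ ^ k a₁ ^ (k - 1) ⋯ a_{k-1}`. -/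
theorem exists_minorIdeal_eq_span_prod [IsDomain A] (hA : ∀ a b : A, a ∣ b ∨ b ∣ a) (n : ℕ) :
    ∀ (r c : Type) [Fintype r] [Fintype c] [DecidableEq r] [DecidableEq c] (M : Matrix r c A),
      Fintype.card r = n →
      ∃ a : ℕ → A, ∀ k, minorIdeal M k = Ideal.span {∏ i ∈ Finset.range k, a i ^ (k - i)} := by
  have zero_case (r c : Type) (M : Matrix r c A) (h : ∀ i j, M i j = 0) :
      ∃ a : ℕ → A, ∀ k, minorIdeal M k = Ideal.span {∏ i ∈ Finset.range k, a i ^ (k - i)} := by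
    refine ⟨0, fun k => ?_⟩
    rcases k with _ | k
    · simp [minorIdeal_zero]
    · rw [Finset.prod_eq_zero (Finset.mem_range.2 (Nat.succ_pos k)) (by simp),
        Ideal.span_singleton_zero,
        eq_bot_iff]
      refine minorIdeal_le fun f g => ?_
      rw [Matrix.det_eq_zero_of_row_eq_zero 0 (fun j => by simp [h])]
      exact zero_mem _
  induction n with
  | zero =>
    intro r c _ _ _ _ M hr
    have := Fintype.card_eq_zero_iff.1 hr
    exact zero_case r c M fun i => isEmptyElim i
  | succ n ih =>
    intro r c _ _ _ _ M hr
    by_cases hM : ∀ i j, M i j = 0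
    · exact zero_case r c M hM
    push Not at hM
    obtain ⟨i₁, j₁, h₁⟩ := hM
    -- Total divisibility provides an entry dividing all the others. Once it is factored out of the
    -- matrix it becomes a pivot equal to 1.
    obtain ⟨⟨i₀, j₀⟩, -, h₀⟩ := exists_dvd_all hA (Finset.univ : Finset (r × c))
      ⟨(i₁, j₁), by simp⟩ (fun x => M x.1 x.2)
    have hne : M i₀ j₀ ≠ 0 := fun h => h₁ (by simpa [h] using h₀ (i₁, j₁) (by simp))
    have h₀' : ∀ i j, ∃ y, M i j = M i₀ j₀ * y := fun i j => h₀ (i, j) (by simp)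
    choose M₀ hM₀ using h₀'
    have hpiv : M₀ i₀ j₀ = 1 :=
      mul_left_cancel₀ hne ((hM₀ i₀ j₀).symm.trans (mul_one _).symm)
    obtain ⟨M', hM'⟩ := exists_pivot (Matrix.of M₀) i₀ j₀ hpiv
    obtain ⟨a, ha⟩ := ih _ _ M' (by simp [hr])
    have hMs : M = M i₀ j₀ • Matrix.of M₀ := by
      ext i j
      simpa using hM₀ i j
    -- The extracted entry is `a 0`; it scales a `(k + 1)`-minor by its `(k + 1)`-th power, and the
    -- Schur complement supplies the later factors.
    refine ⟨fun i => Nat.casesOn i (M i₀ j₀) a, fun k => ?_⟩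
    rcases k with _ | k
    · simp [minorIdeal_zero]
    · conv_lhs => rw [hMs]
      rw [minorIdeal_smul, hM', ha, Ideal.span_singleton_mul_span_singleton,
        Finset.prod_range_succ', mul_comm]
      simp

end MinorIdeal

/-! ### Gcds in a factorial ring through localization at prime elements. -/

section LocalGlobal

variable {R : Type*} [CommRing R]

theorem IsGCDOf.associated [IsDomain R] {S : Set R} {x y : R} (hx : IsGCDOf S x)
    (hy : IsGCDOf S y) : Associated x y :=
  associated_of_dvd_dvd (hy.2 _ hx.1) (hx.2 _ hy.1)

theorem IsGCDOf.congr [IsDomain R] {S : Set R} {x y : R} (hx : IsGCDOf S x)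
    (h : Associated x y) : IsGCDOf S y :=
  ⟨fun z hz => h.symm.dvd.trans (hx.1 z hz), fun z hz => (hx.2 z hz).trans h.dvd⟩

theorem isGCDOf_of_span_eq {S T : Set R} (h : Ideal.span S = Ideal.span T) {x : R}
    (hx : IsGCDOf S x) : IsGCDOf T x := by
  have key (z : R) (U : Set R) : (∀ y ∈ U, z ∣ y) ↔ Ideal.span U ≤ Ideal.span {z} := by
    rw [Ideal.span_le]
    exact forall₂_congr fun y _ => Ideal.mem_span_singleton.symm
  refine ⟨?_, fun z hz => hx.2 z ?_⟩
  · rw [key, ← h, ← key]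
    exact hx.1
  · rw [key, h, ← key]
    exact hz

theorem exists_isGCDOf [IsDomain R] [UniqueFactorizationMonoid R] {S : Set R} (hS : S.Finite) :
    ∃ x, IsGCDOf S x := by
  classical
  let _ := UniqueFactorizationMonoid.toGCDMonoid R
  induction S, hS using Set.Finite.induction_on with
  | empty => exact ⟨0, by simp [IsGCDOf]⟩
  | @insert a s ha hs ih =>
    obtain ⟨x, h1, h2⟩ := ih
    refine ⟨gcd a x, ?_, fun z hz => ?_⟩
    · intro y hy
      rcases Set.mem_insert_iff.1 hy with rfl | hy
      · exact gcd_dvd_left _ _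
      · exact (gcd_dvd_right _ _).trans (h1 y hy)
    · exact dvd_gcd (hz a (Set.mem_insert _ _)) (h2 z fun y hy => hz y (Set.mem_insert_of_mem _ hy))

theorem finite_minors {r c : Type*} [Finite r] [Finite c] (M : Matrix r c R) (k : ℕ) :
    (minors M k).Finite := by
  have : minors M k = Set.range
      (fun x : (Fin k ↪ r) × (Fin k ↪ c) => (M.submatrix x.1 x.2).det) := by
    ext y
    simp [minors, eq_comm]
  rw [this]
  exact Set.finite_range _

theorem isUnit_algebraMap_atPrime {π : R} [hP : (Ideal.span {π}).IsPrime] {s : R} (hs : ¬ π ∣ s) :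
    IsUnit (algebraMap R (Localization.AtPrime (Ideal.span {π})) s) :=
  IsLocalization.map_units (M := (Ideal.span {π}).primeCompl) _
    ⟨s, fun h => hs (Ideal.mem_span_singleton.1 h)⟩

/-- If `x ≠ 0`, then `x * π` is not a common divisor, so some `y ∈ S` is `x` times an element prime
to `π`, which is a unit in the localization. -/
theorem span_image_atPrime [IsDomain R] {π : R} (hπ : Prime π)
    [hP : (Ideal.span {π}).IsPrime] {S : Set R} {x : R} (hx : IsGCDOf S x) :
    Ideal.span (algebraMap R (Localization.AtPrime (Ideal.span {π})) '' S) =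
      Ideal.span {algebraMap R (Localization.AtPrime (Ideal.span {π})) x} := by
  apply le_antisymm
  · rw [Ideal.span_le]
    rintro _ ⟨y, hy, rfl⟩
    exact Ideal.mem_span_singleton.2 (map_dvd _ (hx.1 y hy))
  · rw [Ideal.span_singleton_le_iff_mem]
    by_cases h0 : x = 0
    · simp [h0]
    have : ∃ y ∈ S, ¬ x * π ∣ y := by
      by_contra! h
      have h1 := hx.2 _ h
      rw [← mul_one (x * π), mul_assoc] at h1
      have h2 : x * (π * 1) ∣ x * 1 := by rwa [mul_one x]
      have h3 := (mul_dvd_mul_iff_left h0).1 h2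
      exact hπ.not_dvd_one ((dvd_mul_right _ _).trans h3)
    obtain ⟨y, hy, hxy⟩ := this
    obtain ⟨z, rfl⟩ := hx.1 y hy
    have hz : ¬ π ∣ z := fun h => hxy (mul_dvd_mul_left _ h)
    have hu := isUnit_algebraMap_atPrime hz
    have := Ideal.subset_span (s := algebraMap R (Localization.AtPrime (Ideal.span {π})) '' S)
      ⟨_, hy, rfl⟩
    rw [map_mul] at this
    exact (Ideal.mul_unit_mem_iff_mem _ hu).1 this

/-- After cancelling a gcd, `π` cannot divide both cofactors, so one of them becomes a unit. -/
theorem dvd_total_atPrime [IsDomain R] [UniqueFactorizationMonoid R] {π : R} (hπ : Prime π)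
    [hP : (Ideal.span {π}).IsPrime] (a b : Localization.AtPrime (Ideal.span {π})) :
    a ∣ b ∨ b ∣ a := by
  classical
  let _ := UniqueFactorizationMonoid.toGCDMonoid R
  have key (x y : R) : algebraMap R (Localization.AtPrime (Ideal.span {π})) x ∣ algebraMap R _ y ∨
      algebraMap R (Localization.AtPrime (Ideal.span {π})) y ∣ algebraMap R _ x := by
    by_cases h0 : x = 0
    · right; simp [h0]
    obtain ⟨x', y', hx, hy, hu⟩ := extract_gcd x y
    generalize gcd x y = g at hx hy
    have : ¬ π ∣ x' ∨ ¬ π ∣ y' := by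
      by_contra! h
      exact hπ.not_isUnit ((isUnit_of_dvd_unit (dvd_gcd h.1 h.2) hu))
    rcases this with h | h
    · left
      rw [hx, hy, map_mul, map_mul]
      exact mul_dvd_mul_left _ (isUnit_algebraMap_atPrime h).dvd
    · right
      rw [hx, hy, map_mul, map_mul]
      exact mul_dvd_mul_left _ (isUnit_algebraMap_atPrime h).dvd
  obtain ⟨⟨x, s⟩, hx⟩ := IsLocalization.surj (Ideal.span {π}).primeCompl a
  obtain ⟨⟨y, t⟩, hy⟩ := IsLocalization.surj (Ideal.span {π}).primeCompl b
  have hs := IsLocalization.map_units (Localization.AtPrime (Ideal.span {π})) s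
  have ht := IsLocalization.map_units (Localization.AtPrime (Ideal.span {π})) t
  have := key x y
  simp only at hx hy
  rwa [← hx, ← hy, hs.mul_right_dvd, ht.dvd_mul_right, ht.mul_right_dvd, hs.dvd_mul_right] at this

/-- If `x / gcd x y` is not a unit it has a prime factor `π`, and divisibility fails at that `π`.
The existence of a prime serves only for `x = 0`: in a field the local condition would be empty. -/
theorem dvd_of_forall_atPrime [IsDomain R] [UniqueFactorizationMonoid R]
    (hR : ∃ π : R, Prime π) {x y : R} (h : ∀ π : R, Prime π → ∀ [(Ideal.span {π}).IsPrime],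
      algebraMap R (Localization.AtPrime (Ideal.span {π})) x ∣ algebraMap R _ y) : x ∣ y := by
  classical
  let _ := UniqueFactorizationMonoid.toGCDMonoid R
  by_cases hx0 : x = 0
  · obtain ⟨π, hπ⟩ := hR
    have := (Ideal.span_singleton_prime hπ.ne_zero).2 hπ
    have h1 := h π hπ
    rw [hx0, map_zero, zero_dvd_iff] at h1
    have := IsLocalization.injective (Localization.AtPrime (Ideal.span {π}))
      (Ideal.primeCompl_le_nonZeroDivisors (Ideal.span {π}))
    rw [hx0, (injective_iff_map_eq_zero _).1 this y h1]
  have hg0 : gcd x y ≠ 0 := fun h => hx0 ((gcd_eq_zero_iff _ _).1 h).1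
  obtain ⟨x', y', hx, hy, hu⟩ := extract_gcd x y
  generalize gcd x y = g at hx hy hg0
  have hx' : IsUnit x' := by
    by_contra hx'
    have hx'0 : x' ≠ 0 := by rintro rfl; simp at hx; exact hx0 hx
    obtain ⟨π, hπ, hd⟩ := WfDvdMonoid.exists_irreducible_factor hx' hx'0
    have hπ := hπ.prime
    have := (Ideal.span_singleton_prime hπ.ne_zero).2 hπ
    have h1 := h π hπ
    obtain ⟨z, hz⟩ := h1
    obtain ⟨⟨w, s⟩, hw⟩ := IsLocalization.surj (Ideal.span {π}).primeCompl z
    have inj := IsLocalization.injective (Localization.AtPrime (Ideal.span {π}))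
        (Ideal.primeCompl_le_nonZeroDivisors (Ideal.span {π}))
    have h2 : y * s = x * w := by
      apply inj
      rw [map_mul, hz, mul_assoc, hw, map_mul]
    rw [hx, hy, mul_assoc, mul_assoc] at h2
    have h3 := mul_left_cancel₀ hg0 h2
    have h4 : π ∣ y' * s := h3 ▸ hd.mul_right w
    rcases hπ.dvd_or_dvd h4 with h5 | h5
    · exact hπ.not_isUnit (isUnit_of_dvd_unit (dvd_gcd hd h5) hu)
    · exact s.2 (Ideal.mem_span_singleton.2 h5)
  rw [hx, hy]
  exact mul_dvd_mul_left _ hx'.dvd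

theorem associated_of_forall_atPrime [IsDomain R] [UniqueFactorizationMonoid R]
    (hR : ∃ π : R, Prime π) {S T : Set R} {x y : R} (hx : IsGCDOf S x) (hy : IsGCDOf T y)
    (h : ∀ π : R, Prime π → ∀ [(Ideal.span {π}).IsPrime],
      Ideal.span (algebraMap R (Localization.AtPrime (Ideal.span {π})) '' S) =
        Ideal.span (algebraMap R (Localization.AtPrime (Ideal.span {π})) '' T)) :
    Associated x y := by
  have key (π : R) (hπ : Prime π) [(Ideal.span {π}).IsPrime] :
      Associated (algebraMap R (Localization.AtPrime (Ideal.span {π})) x) (algebraMap R _ y) := by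
    rw [← Ideal.span_singleton_eq_span_singleton, ← span_image_atPrime hπ hx,
      ← span_image_atPrime hπ hy, h π hπ]
  exact associated_of_dvd_dvd (dvd_of_forall_atPrime hR fun π hπ _ => (key π hπ).dvd)
    (dvd_of_forall_atPrime hR fun π hπ _ => (key π hπ).symm.dvd)

/-- The exponent of `a i` is the positive part of `k - i`, whose second difference in `k` is
concentrated at `i = k + 1`. -/
theorem prod_pow_sub_mul {A : Type*} [CommMonoid A] (a : ℕ → A) (k : ℕ) :
    (∏ i ∈ Finset.range (k + 2), a i ^ (k + 2 - i)) * ∏ i ∈ Finset.range k, a i ^ (k - i) =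
      a (k + 1) * (∏ i ∈ Finset.range (k + 1), a i ^ (k + 1 - i)) ^ 2 := by
  have h : (∏ i ∈ Finset.range k, a i ^ (k + 2 - i)) * ∏ i ∈ Finset.range k, a i ^ (k - i) =
      (∏ i ∈ Finset.range k, a i ^ (k + 1 - i)) ^ 2 := by
    rw [← Finset.prod_mul_distrib, ← Finset.prod_pow]
    refine Finset.prod_congr rfl fun i hi => ?_
    have := Finset.mem_range.1 hi
    rw [← pow_add, ← pow_mul]
    congr 1
    omega
  have e1 : k + 2 - k = 2 := by omega
  have e2 : k + 2 - (k + 1) = 1 := by omega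
  have e3 : k + 1 - k = 1 := by omega
  rw [Finset.prod_range_succ, Finset.prod_range_succ, Finset.prod_range_succ _ k, mul_pow, ← h, e1,
    e2, e3, pow_one, pow_one]
  ac_rfl

/-- The greatest common divisors of the minors of consecutive sizes form a log-convex sequence. -/
theorem sq_dvd_mul_of_isGCDOf_minors [IsDomain R] [UniqueFactorizationMonoid R]
    (hR : ∃ π : R, Prime π) {r c : Type} [Fintype r] [Fintype c] (M : Matrix r c R) {G : ℕ → R}
    (hG : ∀ k, IsGCDOf (minors M k) (G k)) (k : ℕ) : G (k + 1) ^ 2 ∣ G (k + 2) * G k := by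
  classical
  refine dvd_of_forall_atPrime hR fun π hπ _ => ?_
  obtain ⟨a, ha⟩ := exists_minorIdeal_eq_span_prod (dvd_total_atPrime hπ) (Fintype.card r) r c
    (M.map (algebraMap R (Localization.AtPrime (Ideal.span {π})))) rfl
  have h (l : ℕ) := ha l
  simp only [minorIdeal_map, span_image_atPrime hπ (hG _),
    Ideal.span_singleton_eq_span_singleton] at h
  rw [map_pow, map_mul]
  refine (((h (k + 1)).pow_pow (n := 2)).dvd.trans ?_).trans ((h (k + 2)).mul_mul (h k)).symm.dvd
  rw [prod_pow_sub_mul]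
  exact dvd_mul_left _ _

end LocalGlobal

/-! ### Coefficient matrices of families of polynomials, and splitting off evaluation at a point. -/

section CoeffMatrix

variable {A : Type*} [CommRing A]

/-- The matrix of the coefficients (up to degree `L - 1`) of a family of polynomials. -/
def coeffMatrix {ι : Type*} (L : ℕ) (w : ι → A[X]) : Matrix (Fin L) ι A :=
  Matrix.of fun r c => (w c).coeff r

/-- Consequently the ideals of minors depend only on the span of the family, even when the families
have different index types. -/
theorem minorIdeal_coeffMatrix_mono {ι κ : Type*} [Fintype ι] (L k : ℕ) {w : ι → A[X]}
    {w' : κ → A[X]} (h : ∀ i, w' i ∈ Submodule.span A (Set.range w)) :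
    minorIdeal (coeffMatrix L w') k ≤ minorIdeal (coeffMatrix L w) k := by
  choose a ha using fun i => (Submodule.mem_span_range_iff_exists_fun A).1 (h i)
  have : coeffMatrix L w' = coeffMatrix L w * Matrix.of (fun l i => a i l) := by
    ext r i
    simp [coeffMatrix, Matrix.mul_apply, ← ha, Polynomial.finsetSum_coeff, mul_comm]
  rw [this]
  exact minorIdeal_mul_le_left _ _ _

theorem mem_degreeLT_of_natDegree_lt {p : A[X]} {d : ℕ} (h : p.natDegree < d) :
    p ∈ Polynomial.degreeLT A d := by
  rw [Polynomial.mem_degreeLT]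
  exact Polynomial.degree_le_natDegree.trans_lt (by exact_mod_cast h)

theorem mem_degreeLT_iff_coeff {p : A[X]} {d : ℕ} :
    p ∈ Polynomial.degreeLT A d ↔ ∀ l, d ≤ l → p.coeff l = 0 := by
  rw [Polynomial.mem_degreeLT, Polynomial.degree_lt_iff_coeff_zero]

theorem eq_sum_of_mem_degreeLT {p : A[X]} {d : ℕ} (h : p ∈ Polynomial.degreeLT A d) :
    p = ∑ l : Fin d, p.coeff l • (Polynomial.X : A[X]) ^ (l : ℕ) := by
  rw [Finset.sum_fin_eq_sum_range]
  ext k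
  simp only [Polynomial.finsetSum_coeff]
  by_cases hk : k < d
  · rw [Finset.sum_eq_single k]
    · simp [hk]
    · intro b hb hbk
      simp [Finset.mem_range.1 hb, Polynomial.coeff_X_pow, hbk.symm]
    · simp [hk]
  · rw [mem_degreeLT_iff_coeff.1 h k (not_lt.1 hk), Finset.sum_eq_zero]
    intro b hb
    have : k ≠ b := by have := Finset.mem_range.1 hb; omega
    simp [Finset.mem_range.1 hb, Polynomial.coeff_X_pow, this]

theorem mul_mem_of_mem_degreeLT {p f : A[X]} {d : ℕ} (h : p ∈ Polynomial.degreeLT A d)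
    {W : Submodule A A[X]} (hW : ∀ l < d, Polynomial.X ^ l * f ∈ W) : p * f ∈ W := by
  rw [eq_sum_of_mem_degreeLT h, Finset.sum_mul]
  refine Submodule.sum_mem _ fun l _ => ?_
  rw [smul_mul_assoc]
  exact W.smul_mem _ (hW l l.2)

theorem mem_degreeLT_of_X_sub_C_mul_mem [Nontrivial A] {c : A} {q : A[X]} {L : ℕ}
    (h : (Polynomial.X - Polynomial.C c) * q ∈ Polynomial.degreeLT A (L + 1)) :
    q ∈ Polynomial.degreeLT A L := by
  by_cases hq0 : q = 0
  · simp [hq0]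
  apply mem_degreeLT_of_natDegree_lt
  have h2 := (Polynomial.monic_X_sub_C c).natDegree_mul' hq0
  rw [Polynomial.natDegree_X_sub_C] at h2
  have h3 : (Polynomial.X - Polynomial.C c) * q ≠ 0 := fun h0 =>
    hq0 ((Polynomial.monic_X_sub_C c).mul_right_eq_zero_iff.1 h0)
  rw [Polynomial.mem_degreeLT] at h
  have := (Polynomial.natDegree_lt_iff_degree_lt h3).2 h
  omega

/-- Since `z` has value 1 at `c`, it forms with the `(X - c) X ^ l` a basis of the polynomials of
degree at most `L`; in this basis the family has matrix 1 ⊕ `coeffMatrix L w`. -/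
theorem minorIdeal_coeffMatrix_sumElim [Nontrivial A] {ι : Type*} [Fintype ι] [DecidableEq ι]
    {L : ℕ} {c : A} {z : A[X]} {w : ι → A[X]} (hz : z.eval c = 1)
    (hzL : z ∈ Polynomial.degreeLT A (L + 1)) (hw : ∀ i, w i ∈ Polynomial.degreeLT A L) (k : ℕ) :
    minorIdeal (coeffMatrix (L + 1)
      (Sum.elim (fun _ : Unit => z) fun i => (Polynomial.X - Polynomial.C c) * w i)) (k + 1) =
    minorIdeal (coeffMatrix L w) k := by
  let b : Unit ⊕ Fin L → A[X] :=
    Sum.elim (fun _ : Unit => z) fun l => (Polynomial.X - Polynomial.C c) * Polynomial.X ^ (l : ℕ)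
  have hfac : coeffMatrix (L + 1)
      (Sum.elim (fun _ : Unit => z) fun i => (Polynomial.X - Polynomial.C c) * w i) =
      coeffMatrix (L + 1) b * Matrix.fromBlocks (1 : Matrix Unit Unit A) 0 0 (coeffMatrix L w) := by
    ext r i
    rcases i with i | i
    · simp [Matrix.mul_apply, coeffMatrix, b]
    · rw [Matrix.mul_apply, Fintype.sum_sum_type]
      simp only [coeffMatrix, Matrix.of_apply, Sum.elim_inr, Finset.univ_unique, Sum.elim_inl,
        Matrix.fromBlocks_apply₁₂, Matrix.zero_apply, mul_zero, Finset.sum_const_zero,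
        Matrix.fromBlocks_apply₂₂, zero_add, b]
      conv_lhs => rw [eq_sum_of_mem_degreeLT (hw i), Finset.mul_sum, Polynomial.finsetSum_coeff]
      refine Finset.sum_congr rfl fun l _ => ?_
      rw [mul_smul_comm, Polynomial.coeff_smul, smul_eq_mul, mul_comm]
  -- Taylor-like splitting `p = p(c) z + (X - c) q`, with `q` of degree less than `L`.
  have hspan (p : A[X]) (hp : p ∈ Polynomial.degreeLT A (L + 1)) :
      p ∈ Submodule.span A (Set.range b) := by
    have hroot : (p - p.eval c • z).IsRoot c := by simp [Polynomial.IsRoot, hz]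
    obtain ⟨q, hq⟩ := Polynomial.dvd_iff_isRoot.2 hroot
    have hqL : q ∈ Polynomial.degreeLT A L := mem_degreeLT_of_X_sub_C_mul_mem
      (hq ▸ Submodule.sub_mem _ hp (Submodule.smul_mem _ _ hzL))
    have : p = p.eval c • z + (Polynomial.X - Polynomial.C c) * q := by rw [← hq]; ring
    rw [this]
    refine Submodule.add_mem _ (Submodule.smul_mem _ _ (Submodule.subset_span ⟨Sum.inl (), rfl⟩)) ?_
    rw [mul_comm]
    refine mul_mem_of_mem_degreeLT hqL fun l hl => Submodule.subset_span ⟨Sum.inr ⟨l, hl⟩, ?_⟩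
    simp [b, mul_comm]
  have hX (i : Fin (L + 1)) : ∃ a : Unit ⊕ Fin L → A, ∑ l, a l • b l = Polynomial.X ^ (i : ℕ) :=
    (Submodule.mem_span_range_iff_exists_fun A).1
      (hspan _ (mem_degreeLT_of_natDegree_lt (by simpa using i.2)))
  choose a ha using hX
  have hinv : coeffMatrix (L + 1) b * Matrix.of (fun l i => a i l) = 1 := by
    ext r i
    have := congrArg (fun p => Polynomial.coeff p r) (ha i)
    simp only [Polynomial.finsetSum_coeff, Polynomial.coeff_smul, smul_eq_mul,
      Polynomial.coeff_X_pow] at this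
    rw [Matrix.mul_apply, Matrix.one_apply]
    simp only [Fin.ext_iff, ← this, coeffMatrix, Matrix.of_apply]
    exact Finset.sum_congr rfl fun l _ => mul_comm _ _
  have e : Fin (L + 1) ≃ Unit ⊕ Fin L := Fintype.equivOfCardEq (by simp [add_comm])
  have hinv' := (Matrix.mul_eq_one_comm_of_equiv e).1 hinv
  rw [← minorIdeal_one_block (coeffMatrix L w)]
  apply le_antisymm
  · rw [hfac]
    exact minorIdeal_mul_le_right _ _ _
  · have h := congrArg (fun M => Matrix.of (fun l i => a i l) * M) hfac
    simp only [← Matrix.mul_assoc, hinv', Matrix.one_mul] at h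
    rw [← h]
    exact minorIdeal_mul_le_right _ _ _

end CoeffMatrix

/-! ### Passing from ψ_j to ψ_{j+1}. -/

section HybridStep

variable {A : Type*} [CommRing A]

theorem coeff_upperPart {n : ℕ} {f : A[X]} (hf : f.natDegree ≤ n) (e l : ℕ) :
    (upperPart n e f).coeff l = f.coeff (e + l) := by
  simp only [upperPart, Polynomial.finsetSum_coeff, Polynomial.coeff_C_mul, Polynomial.coeff_X_pow,
    mul_ite, mul_one, mul_zero, Finset.sum_ite_eq, Finset.mem_range]
  split_ifs with h
  · rfl
  · exact (Polynomial.coeff_eq_zero_of_natDegree_lt (by omega)).symm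

theorem upperPart_zero {n : ℕ} {f : A[X]} (hf : f.natDegree ≤ n) : upperPart n 0 f = f := by
  ext l
  rw [coeff_upperPart hf, zero_add]

theorem X_mul_upperPart_succ {n : ℕ} {f : A[X]} (hf : f.natDegree ≤ n) (e : ℕ) :
    Polynomial.X * upperPart n (e + 1) f = upperPart n e f - Polynomial.C (f.coeff e) := by
  ext l
  rcases l with _ | l
  · simp [coeff_upperPart hf]
  · rw [Polynomial.coeff_X_mul, Polynomial.coeff_sub, coeff_upperPart hf, coeff_upperPart hf,
      Polynomial.coeff_C_succ, sub_zero]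
    congr 1
    omega

theorem upperPart_mem_degreeLT {n : ℕ} {f : A[X]} (hf : f.natDegree ≤ n) {e d : ℕ}
    (h : n < e + d) : upperPart n e f ∈ Polynomial.degreeLT A d := by
  rw [mem_degreeLT_iff_coeff]
  intro l hl
  rw [coeff_upperPart hf, Polynomial.coeff_eq_zero_of_natDegree_lt (by omega)]

/-- The polynomial `p_{m - e} = g_{m - e} f - f_{m - e} g`, indexed by `e = m - k`. -/
def bezoutDiff (n m : ℕ) (f g : A[X]) (e : ℕ) : A[X] :=
  upperPart m e g * f - upperPart n e f * g

/-- The recursion behind all comparisons below: multiplication by `X` lowers the index `e` by one,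
up to a combination of `f` and `g`. -/
theorem X_mul_bezoutDiff_succ {n m : ℕ} {f g : A[X]} (hf : f.natDegree ≤ n) (hg : g.natDegree ≤ m)
    (e : ℕ) : Polynomial.X * bezoutDiff n m f g (e + 1) =
      bezoutDiff n m f g e + (f.coeff e • g - g.coeff e • f) := by
  have h1 := X_mul_upperPart_succ hf e
  have h2 := X_mul_upperPart_succ hg e
  simp only [bezoutDiff, Polynomial.smul_eq_C_mul]
  linear_combination f * h2 - g * h1

theorem hybridColumn_inl {n m j : ℕ} (hj : j ≤ m) (f g : A[X]) (i : Fin j) :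
    hybridColumn n m j f g (Sum.inl i) = bezoutDiff n m f g (j - i) := by
  have : m - (m - j + i) = j - i := by omega
  simp [hybridColumn, bezoutPoly, bezoutDiff, this]

/-- The image of the map `ψ_j`. -/
def hybridSpan (n m j : ℕ) (f g : A[X]) : Submodule A A[X] :=
  Submodule.span A (Set.range (hybridColumn n m j f g))

theorem X_pow_mul_left_mem_hybridSpan {n m j : ℕ} (f g : A[X]) {l : ℕ} (hl : l < m - j) :
    Polynomial.X ^ l * f ∈ hybridSpan n m j f g :=
  Submodule.subset_span ⟨Sum.inr (Sum.inl ⟨l, hl⟩), rfl⟩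

theorem X_pow_mul_right_mem_hybridSpan {n m j : ℕ} (f g : A[X]) {l : ℕ} (hl : l < n - j) :
    Polynomial.X ^ l * g ∈ hybridSpan n m j f g :=
  Submodule.subset_span ⟨Sum.inr (Sum.inr ⟨l, hl⟩), rfl⟩

theorem bezoutDiff_zero {n m : ℕ} {f g : A[X]} (hf : f.natDegree ≤ n) (hg : g.natDegree ≤ m) :
    bezoutDiff n m f g 0 = 0 := by
  rw [bezoutDiff, upperPart_zero hf, upperPart_zero hg]
  ring

theorem bezoutDiff_mem_hybridSpan {n m j : ℕ} (hj : j ≤ m) {f g : A[X]} (hf : f.natDegree ≤ n)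
    (hg : g.natDegree ≤ m) {e : ℕ} (he : e ≤ j) :
    bezoutDiff n m f g e ∈ hybridSpan n m j f g := by
  rcases Nat.eq_zero_or_pos e with rfl | he0
  · rw [bezoutDiff_zero hf hg]
    exact zero_mem _
  · refine Submodule.subset_span ⟨Sum.inl ⟨j - e, by omega⟩, ?_⟩
    rw [hybridColumn_inl hj]
    congr 1
    simp only
    omega

theorem hybridSpan_le {n m j : ℕ} (hj : j ≤ m) {f g : A[X]} {W : Submodule A A[X]}
    (h1 : ∀ e, 1 ≤ e → e ≤ j → bezoutDiff n m f g e ∈ W)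
    (h2 : ∀ l < m - j, Polynomial.X ^ l * f ∈ W) (h3 : ∀ l < n - j, Polynomial.X ^ l * g ∈ W) :
    hybridSpan n m j f g ≤ W := by
  refine Submodule.span_le.2 ?_
  rintro _ ⟨i | l | l, rfl⟩
  · rw [hybridColumn_inl hj]
    exact h1 _ (by omega) (by omega)
  · exact h2 l l.2
  · exact h3 l l.2

/-- Replacing `f` and `g` by their parts of degree less than `e` does not change the difference,
because the terms in `X ^ e` cancel; the bound is then (n - e) + (e - 1). -/
theorem bezoutDiff_mem_degreeLT {n m : ℕ} (hmn : m ≤ n) {f g : A[X]} (hf : f.natDegree ≤ n)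
    (hg : g.natDegree ≤ m) {e : ℕ} (he : 1 ≤ e) (hem : e ≤ m) :
    bezoutDiff n m f g e ∈ Polynomial.degreeLT A n := by
  have low {d : ℕ} {p : A[X]} (hp : p.natDegree ≤ d) :
      (p - Polynomial.X ^ e * upperPart d e p).natDegree ≤ e - 1 := by
    rw [Polynomial.natDegree_le_iff_coeff_eq_zero]
    intro l hl
    obtain ⟨l', rfl⟩ : ∃ l', l = l' + e := ⟨l - e, by omega⟩
    rw [Polynomial.coeff_sub, Polynomial.coeff_X_pow_mul, coeff_upperPart hp, add_comm e, sub_self]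
  have up {d : ℕ} {p : A[X]} (hp : p.natDegree ≤ d) : (upperPart d e p).natDegree ≤ d - e := by
    rw [Polynomial.natDegree_le_iff_coeff_eq_zero]
    intro l hl
    rw [coeff_upperPart hp, Polynomial.coeff_eq_zero_of_natDegree_lt (by omega)]
  have heq : bezoutDiff n m f g e =
      upperPart m e g * (f - Polynomial.X ^ e * upperPart n e f) -
        upperPart n e f * (g - Polynomial.X ^ e * upperPart m e g) := by
    rw [bezoutDiff]
    ring
  rw [heq]
  refine Submodule.sub_mem _ (mem_degreeLT_of_natDegree_lt ?_) (mem_degreeLT_of_natDegree_lt ?_)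
  · have := Polynomial.natDegree_mul_le_of_le (up hg) (low hf)
    omega
  · have := Polynomial.natDegree_mul_le_of_le (up hf) (low hg)
    omega

theorem hybridSpan_le_degreeLT {n m j : ℕ} (hmn : m ≤ n) (hj : j ≤ m) {f g : A[X]}
    (hf : f.natDegree ≤ n) (hg : g.natDegree ≤ m) :
    hybridSpan n m j f g ≤ Polynomial.degreeLT A (m + n - j) := by
  refine hybridSpan_le hj (fun e h1 h2 => ?_) (fun l hl => ?_) fun l hl => ?_
  · exact Polynomial.degreeLT_mono (by omega)
      (bezoutDiff_mem_degreeLT hmn hf hg h1 (h2.trans hj))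
  · have := Polynomial.natDegree_mul_le_of_le (Polynomial.natDegree_X_pow_le (R := A) l) hf
    exact mem_degreeLT_of_natDegree_lt (by omega)
  · have := Polynomial.natDegree_mul_le_of_le (Polynomial.natDegree_X_pow_le (R := A) l) hg
    exact mem_degreeLT_of_natDegree_lt (by omega)

theorem X_sub_C_mul_mem_hybridSpan {n m j : ℕ} (hmn : m ≤ n) (hj : j < m) {f g : A[X]}
    (hf : f.natDegree ≤ n) (hg : g.natDegree ≤ m) (c : A) {p : A[X]}
    (hp : p ∈ hybridSpan n m (j + 1) f g) :
    (Polynomial.X - Polynomial.C c) * p ∈ hybridSpan n m j f g := by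
  set W := hybridSpan n m j f g with hW
  have hfW : ∀ l < m - j, Polynomial.X ^ l * f ∈ W := fun l => X_pow_mul_left_mem_hybridSpan f g
  have hgW : ∀ l < n - j, Polynomial.X ^ l * g ∈ W := fun l => X_pow_mul_right_mem_hybridSpan f g
  have h0f : f ∈ W := by simpa using hfW 0 (by omega)
  have h0g : g ∈ W := by simpa using hgW 0 (by omega)
  -- For `e ≤ j` this is a column of ψ_j or zero; for `e = j + 1` the two upper parts have low
  -- enough degree for the Bézout polynomial to be a combination of shifts of `f` and `g`.
  have hb (e : ℕ) (he : e ≤ j + 1) : bezoutDiff n m f g e ∈ W := by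
    rcases he.lt_or_eq with h | rfl
    · exact bezoutDiff_mem_hybridSpan hj.le hf hg (by omega)
    · exact Submodule.sub_mem _
        (mul_mem_of_mem_degreeLT (upperPart_mem_degreeLT hg (by omega)) hfW)
        (mul_mem_of_mem_degreeLT (upperPart_mem_degreeLT hf (by omega)) hgW)
  suffices h : hybridSpan n m (j + 1) f g ≤
      W.comap (LinearMap.mulLeft A (Polynomial.X - Polynomial.C c)) from h hp
  refine hybridSpan_le hj (fun e h1 h2 => ?_) (fun l hl => ?_) fun l hl => ?_
  · obtain ⟨e, rfl⟩ : ∃ e', e = e' + 1 := ⟨e - 1, by omega⟩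
    change (Polynomial.X - Polynomial.C c) * _ ∈ W
    rw [sub_mul, X_mul_bezoutDiff_succ hf hg, ← Polynomial.smul_eq_C_mul]
    exact W.sub_mem (W.add_mem (hb _ (by omega)) (W.sub_mem (W.smul_mem _ h0g) (W.smul_mem _ h0f)))
      (W.smul_mem _ (hb _ h2))
  · change (Polynomial.X - Polynomial.C c) * _ ∈ W
    rw [sub_mul, ← mul_assoc, ← pow_succ', ← Polynomial.smul_eq_C_mul]
    exact W.sub_mem (hfW _ (by omega)) (W.smul_mem _ (hfW _ (by omega)))
  · change (Polynomial.X - Polynomial.C c) * _ ∈ W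
    rw [sub_mul, ← mul_assoc, ← pow_succ', ← Polynomial.smul_eq_C_mul]
    exact W.sub_mem (hgW _ (by omega)) (W.smul_mem _ (hgW _ (by omega)))

/-- Complement to `X_sub_C_mul_mem_hybridSpan`: a submodule containing (X - c) · im ψ_{j+1} contains
im ψ_j once it contains `f` and `g`. The Bézout columns are reached by descending from `e = j + 1`
along the recursion. -/
theorem hybridSpan_le_of_X_sub_C_mul_mem {n m j : ℕ} (hj : j < m) (hmn : m ≤ n) {f g : A[X]}
    (hf : f.natDegree ≤ n) (hg : g.natDegree ≤ m) (c : A) {W : Submodule A A[X]}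
    (hW : ∀ p ∈ hybridSpan n m (j + 1) f g, (Polynomial.X - Polynomial.C c) * p ∈ W)
    (h0f : f ∈ W) (h0g : g ∈ W) : hybridSpan n m j f g ≤ W := by
  have hfW : ∀ l < m - j, Polynomial.X ^ l * f ∈ W := by
    intro l hl
    induction l with
    | zero => simpa using h0f
    | succ l ih =>
      have := W.add_mem (hW _ (X_pow_mul_left_mem_hybridSpan f g (l := l) (by omega)))
        (W.smul_mem c (ih (by omega)))
      convert this using 1
      rw [Polynomial.smul_eq_C_mul]
      ring
  have hgW : ∀ l < n - j, Polynomial.X ^ l * g ∈ W := by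
    intro l hl
    induction l with
    | zero => simpa using h0g
    | succ l ih =>
      have := W.add_mem (hW _ (X_pow_mul_right_mem_hybridSpan f g (l := l) (by omega)))
        (W.smul_mem c (ih (by omega)))
      convert this using 1
      rw [Polynomial.smul_eq_C_mul]
      ring
  have hb (i e : ℕ) (he : e + i = j + 1) : bezoutDiff n m f g e ∈ W := by
    induction i generalizing e with
    | zero =>
      obtain rfl : e = j + 1 := by omega
      exact Submodule.sub_mem _
        (mul_mem_of_mem_degreeLT (upperPart_mem_degreeLT hg (by omega)) hfW)
        (mul_mem_of_mem_degreeLT (upperPart_mem_degreeLT hf (by omega)) hgW)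
    | succ i ih =>
      have h1 := ih (e + 1) (by omega)
      have h2 := hW _ (bezoutDiff_mem_hybridSpan (n := n) (e := e + 1) (j := j + 1) hj hf hg
        (by omega))
      have h3 : bezoutDiff n m f g e =
          (Polynomial.X - Polynomial.C c) * bezoutDiff n m f g (e + 1) +
            c • bezoutDiff n m f g (e + 1) - (f.coeff e • g - g.coeff e • f) := by
        have := X_mul_bezoutDiff_succ hf hg e
        rw [Polynomial.smul_eq_C_mul]
        linear_combination -this
      rw [h3]
      exact W.sub_mem (W.add_mem h2 (W.smul_mem _ h1))
        (W.sub_mem (W.smul_mem _ h0g) (W.smul_mem _ h0f))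
  exact hybridSpan_le hj.le (fun e h1 h2 => hb (j + 1 - e) e (by omega)) hfW hgW

/-- Modulo `W`, multiplication by `X` acts on im ψ_{j+1} as multiplication by `c`. Hence each Bézout
polynomial is congruent to the same expression with its two upper parts evaluated at `c`; at `e = 0`
the polynomial vanishes and the upper parts are `g` and `f` themselves. -/
theorem eval_smul_sub_eval_smul_mem {n m j : ℕ} (hj : j < m) (hmn : m ≤ n) {f g : A[X]}
    (hf : f.natDegree ≤ n) (hg : g.natDegree ≤ m) (c : A) {W : Submodule A A[X]}
    (hW : ∀ p ∈ hybridSpan n m (j + 1) f g, (Polynomial.X - Polynomial.C c) * p ∈ W) :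
    g.eval c • f - f.eval c • g ∈ W := by
  -- `p - p(c)` is `X - c` times a polynomial of degree less than `d`, so only shifts of `q`
  -- available in im ψ_{j+1} occur.
  have hrem {p q : A[X]} {d : ℕ} (hp : p ∈ Polynomial.degreeLT A (d + 1))
      (hq : ∀ l < d, Polynomial.X ^ l * q ∈ hybridSpan n m (j + 1) f g) :
      p * q - p.eval c • q ∈ W := by
    rw [Polynomial.smul_eq_C_mul, ← sub_mul]
    rw [eq_sum_of_mem_degreeLT hp, Polynomial.eval_finsetSum, map_sum, ← Finset.sum_sub_distrib,
      Finset.sum_mul]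
    refine W.sum_mem fun l _ => ?_
    have h1 : ((p.coeff l • (Polynomial.X : A[X]) ^ (l : ℕ)) -
        Polynomial.C ((p.coeff l • (Polynomial.X : A[X]) ^ (l : ℕ)).eval c)) * q =
        p.coeff l • ((Polynomial.X - Polynomial.C c) *
          ((∑ i ∈ Finset.range l, Polynomial.X ^ i * Polynomial.C c ^ (l - 1 - i : ℕ)) * q)) := by
      rw [← mul_assoc, mul_comm (Polynomial.X - Polynomial.C c), (Commute.all _ _).geom_sum₂_mul]
      simp [Polynomial.smul_eq_C_mul]
      ring
    rw [h1]
    refine W.smul_mem _ (hW _ ?_)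
    rw [Finset.sum_mul]
    refine Submodule.sum_mem _ fun i hi => ?_
    have := Finset.mem_range.1 hi
    rw [mul_comm (Polynomial.X ^ i), mul_assoc, ← map_pow, ← Polynomial.smul_eq_C_mul]
    exact Submodule.smul_mem _ _ (hq i (by omega))
  have key (i e : ℕ) (he : e + i = j + 1) : bezoutDiff n m f g e -
      ((upperPart m e g).eval c • f - (upperPart n e f).eval c • g) ∈ W := by
    induction i generalizing e with
    | zero =>
      obtain rfl : e = j + 1 := by omega
      have h1 := hrem (p := upperPart m (j + 1) g) (q := f) (d := m - (j + 1))
        (upperPart_mem_degreeLT hg (by omega)) fun l hl => X_pow_mul_left_mem_hybridSpan f g hl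
      have h2 := hrem (p := upperPart n (j + 1) f) (q := g) (d := n - (j + 1))
        (upperPart_mem_degreeLT hf (by omega)) fun l hl => X_pow_mul_right_mem_hybridSpan f g hl
      convert W.sub_mem h1 h2 using 1
      rw [bezoutDiff]
      ring
    | succ i ih =>
      have h1 := ih (e + 1) (by omega)
      have h2 := hW _ (bezoutDiff_mem_hybridSpan (n := n) (e := e + 1) (j := j + 1) hj hf hg
        (by omega))
      convert W.add_mem (W.smul_mem c h1) h2 using 1
      have h3 := X_mul_bezoutDiff_succ hf hg e
      have h4 := congrArg (Polynomial.eval c) (X_mul_upperPart_succ hf e)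
      have h5 := congrArg (Polynomial.eval c) (X_mul_upperPart_succ hg e)
      simp only [Polynomial.eval_mul, Polynomial.eval_X, Polynomial.eval_sub,
        Polynomial.eval_C] at h4 h5
      rw [eq_sub_iff_add_eq] at h4 h5
      simp only [Polynomial.smul_eq_C_mul, ← h4, ← h5, map_add, map_mul] at h3 ⊢
      linear_combination -h3
  have := key (j + 1) 0 (by omega)
  rw [bezoutDiff_zero hf hg, upperPart_zero hf, upperPart_zero hg, zero_sub] at this
  exact W.neg_mem_iff.1 this

/-- If `f(c)` and `g(c)` generate the unit ideal, then `ψ_j` is equivalent to `1 ⊕ ψ_{j+1}`, on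
the level of ideals of minors. -/
theorem minorIdeal_hybridMatrix_succ [Nontrivial A] {n m j : ℕ} (hj : j < m) (hmn : m ≤ n)
    {f g : A[X]} (hf : f.natDegree ≤ n) (hg : g.natDegree ≤ m) {c u v : A}
    (huv : u * f.eval c + v * g.eval c = 1) (k : ℕ) :
    minorIdeal (hybridMatrix n m j f g) (k + 1) = minorIdeal (hybridMatrix n m (j + 1) f g) k := by
  classical
  set w := hybridColumn n m (j + 1) f g with hw
  -- This `z` has value 1 at `c`, and `f`, `g` are recovered from `z` together with `g(c) f - f(c)
  -- g`.
  set z : A[X] := u • f + v • g with hz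
  have hzc : z.eval c = 1 := by simpa [hz] using huv
  have hfj : f ∈ hybridSpan n m j f g := by
    simpa using X_pow_mul_left_mem_hybridSpan (n := n) f g (l := 0) (by omega : 0 < m - j)
  have hgj : g ∈ hybridSpan n m j f g := by
    simpa using X_pow_mul_right_mem_hybridSpan (m := m) f g (l := 0) (by omega : 0 < n - j)
  have hzj : z ∈ hybridSpan n m j f g :=
    Submodule.add_mem _ (Submodule.smul_mem _ _ hfj) (Submodule.smul_mem _ _ hgj)
  have hL : m + n - j = m + n - (j + 1) + 1 := by omega
  have h1 := minorIdeal_coeffMatrix_sumElim (L := m + n - (j + 1)) (w := w) hzc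
    (hL ▸ hybridSpan_le_degreeLT hmn hj.le hf hg hzj)
    (fun i => hybridSpan_le_degreeLT hmn hj hf hg (Submodule.subset_span ⟨i, rfl⟩)) k
  rw [← hL] at h1
  change _ = minorIdeal (coeffMatrix _ w) k
  rw [← h1]
  change minorIdeal (coeffMatrix _ (hybridColumn n m j f g)) (k + 1) = _
  apply le_antisymm
  · refine minorIdeal_coeffMatrix_mono _ _ fun i => ?_
    set W := Submodule.span A (Set.range
      (Sum.elim (fun _ : Unit => z) fun i => (Polynomial.X - Polynomial.C c) * w i)) with hWdef
    have hzW : z ∈ W := Submodule.subset_span ⟨Sum.inl (), rfl⟩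
    have hW : ∀ p ∈ hybridSpan n m (j + 1) f g, (Polynomial.X - Polynomial.C c) * p ∈ W := by
      suffices h : hybridSpan n m (j + 1) f g ≤
          W.comap (LinearMap.mulLeft A (Polynomial.X - Polynomial.C c)) from fun p hp => h hp
      refine Submodule.span_le.2 ?_
      rintro _ ⟨i, rfl⟩
      exact Submodule.subset_span ⟨Sum.inr i, rfl⟩
    have hev := eval_smul_sub_eval_smul_mem hj hmn hf hg c hW
    have huvC : Polynomial.C u * Polynomial.C (f.eval c) + Polynomial.C v * Polynomial.C (g.eval c)
        = 1 := by
      rw [← map_mul, ← map_mul, ← map_add, huv, map_one]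
    have h0f : f ∈ W := by
      have : f = f.eval c • z + v • (g.eval c • f - f.eval c • g) := by
        simp only [hz, Polynomial.smul_eq_C_mul]
        linear_combination -f * huvC
      rw [this]
      exact W.add_mem (W.smul_mem _ hzW) (W.smul_mem _ hev)
    have h0g : g ∈ W := by
      have : g = g.eval c • z - u • (g.eval c • f - f.eval c • g) := by
        simp only [hz, Polynomial.smul_eq_C_mul]
        linear_combination -g * huvC
      rw [this]
      exact W.sub_mem (W.smul_mem _ hzW) (W.smul_mem _ hev)
    exact hybridSpan_le_of_X_sub_C_mul_mem hj hmn hf hg c hW h0f h0g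
      (Submodule.subset_span ⟨i, rfl⟩)
  · refine minorIdeal_coeffMatrix_mono _ _ fun i => ?_
    rcases i with i | i
    · exact hzj
    · exact X_sub_C_mul_mem_hybridSpan hmn hj hf hg c (Submodule.subset_span ⟨i, rfl⟩)

theorem upperPart_map {B : Type*} [CommRing B] (φ : A →+* B) (n e : ℕ) (f : A[X]) :
    upperPart n e (f.map φ) = (upperPart n e f).map φ := by
  simp [upperPart, Polynomial.map_sum]

theorem hybridMatrix_map {B : Type*} [CommRing B] (φ : A →+* B) (n m j : ℕ) (f g : A[X]) :
    hybridMatrix n m j (f.map φ) (g.map φ) = (hybridMatrix n m j f g).map φ := by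
  ext r c
  rcases c with i | l | l <;>
    simp only [hybridMatrix, hybridColumn, bezoutPoly, upperPart_map, Matrix.of_apply,
      Matrix.map_apply, ← Polynomial.coeff_map, Polynomial.map_mul, Polynomial.map_sub,
      Polynomial.map_pow, Polynomial.map_X]

end HybridStep

open MvPolynomial

/-! ### Homogeneous forms in two variables. -/

section Homogeneous

theorem aeval_mul_of_isHomogeneous {σ R S : Type*} [CommSemiring R] [CommSemiring S] [Algebra R S]
    {G : MvPolynomial σ R} {d : ℕ} (hG : G.IsHomogeneous d) (r : S) (x : σ → S) :
    aeval (fun i => r * x i) G = r ^ d * aeval x G := by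
  rw [aeval_def, aeval_def, eval₂_eq, eval₂_eq, Finset.mul_sum]
  refine Finset.sum_congr rfl fun s hs => ?_
  simp only [mul_pow]
  rw [Finset.prod_mul_distrib, Finset.prod_pow_eq_pow_sum, ← hG.degree_eq_sum_deg_support hs]
  ring

theorem sub_aeval_mem {σ R : Type*} [CommRing R] (I : Ideal (MvPolynomial σ R))
    {y : σ → MvPolynomial σ R} (hy : ∀ i, X i - y i ∈ I) (G : MvPolynomial σ R) :
    G - aeval y G ∈ I := by
  rw [← Ideal.Quotient.eq]
  have : Ideal.Quotient.mkₐ R I = (Ideal.Quotient.mkₐ R I).comp (aeval y) := by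
    refine algHom_ext fun i => ?_
    simpa using Ideal.Quotient.eq.2 (hy i)
  exact congrArg (fun h => h G) this

theorem aeval_C_eq_C_eval {σ : Type*} (a : σ → ℂ) (G : MvPolynomial σ ℂ) :
    aeval (fun i => (C (a i) : Forms)) G = C (eval a G) := by
  have : (aeval (fun i => (C (a i) : Forms))) = (Algebra.ofId ℂ Forms).comp (aeval a) := by
    refine algHom_ext fun i => ?_
    simp [Algebra.ofId_apply, algebraMap_eq]
  rw [this]
  simp [Algebra.ofId_apply, algebraMap_eq]

/-- Modulo `X 0 - c X 1`, the form `G` is congruent to `X 1 ^ d` times its value at `(c, 1)`. -/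
theorem dvd_of_eval_affine_eq_zero {G : Forms} {d : ℕ} (hG : G.IsHomogeneous d) {c : ℂ}
    (h : eval ![c, 1] G = 0) : X 0 - C c * X 1 ∣ G := by
  have h1 := sub_aeval_mem (Ideal.span {(X 0 - C c * X 1 : Forms)})
    (y := fun i => X 1 * C (![c, 1] i)) (fun i => by
      fin_cases i
      · simp [mul_comm]
      · simp) G
  rw [aeval_mul_of_isHomogeneous hG, aeval_C_eq_C_eval, h, map_zero, mul_zero, sub_zero] at h1
  exact Ideal.mem_span_singleton.1 h1

theorem dvd_of_eval_infinity_eq_zero {G : Forms} {d : ℕ} (hG : G.IsHomogeneous d)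
    (h : eval ![1, 0] G = 0) : X 1 ∣ G := by
  have h1 := sub_aeval_mem (Ideal.span {(X 1 : Forms)})
    (y := fun i => X 0 * C (![1, 0] i)) (fun i => by
      fin_cases i
      · simp
      · simp) G
  rw [aeval_mul_of_isHomogeneous hG, aeval_C_eq_C_eval, h, map_zero, mul_zero, sub_zero] at h1
  exact Ideal.mem_span_singleton.1 h1

theorem eval_mul_of_isHomogeneous {σ : Type*} {G : MvPolynomial σ ℂ} {d : ℕ}
    (hG : G.IsHomogeneous d) (r : ℂ) (x : σ → ℂ) :
    eval (fun i => r * x i) G = r ^ d * eval x G :=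
  aeval_mul_of_isHomogeneous hG r x

theorem eq_zero_of_eval_affine_eq_zero {G : Forms} {d : ℕ} (hG : G.IsHomogeneous d)
    (h : ∀ c : ℂ, eval ![c, 1] G = 0) : G = 0 := by
  -- The factor `X 1` disposes of the points whose second coordinate is zero.
  have h1 : X 1 * G = 0 := by
    refine ((isHomogeneous_X ℂ 1).mul hG).eq_zero_of_forall_eval_eq_zero fun r => ?_
    rw [map_mul, eval_X]
    by_cases hr : r 1 = 0
    · rw [hr, zero_mul]
    · have : r = fun i => r 1 * ![r 0 / r 1, 1] i := by
        ext i
        fin_cases i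
        · simp [mul_div_cancel₀ _ hr]
        · simp
      rw [this, eval_mul_of_isHomogeneous hG, h, mul_zero, mul_zero]
  exact (mul_eq_zero.1 h1).resolve_left (X_ne_zero _)

theorem exists_prime_forms : ∃ π : Forms, Prime π := ⟨X 0, X_prime⟩

/-- Scaling both variables by a new one, via `θ`, turns the grading into the degree in that
variable. Degree minus trailing degree is additive on products and zero for `θ h`, hence zero for `θ
x`. -/
theorem isHomogeneous_of_dvd {x h : Forms} {d : ℕ} (hh : h.IsHomogeneous d) (h0 : h ≠ 0)
    (hx : x ∣ h) : ∃ e, x.IsHomogeneous e := by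
  obtain ⟨y, rfl⟩ := hx
  obtain ⟨θ, hθ⟩ : ∃ θ : Forms →ₐ[ℂ] Forms[X], ∀ {G : Forms} {e : ℕ}, G.IsHomogeneous e →
      θ G = Polynomial.X ^ e * Polynomial.C G := by
    refine ⟨aeval fun i => Polynomial.X * Polynomial.C (X i), fun {G e} hG => ?_⟩
    have h1 := aeval_mul_of_isHomogeneous hG (Polynomial.X : Forms[X])
      (fun i => Polynomial.C (X i : Forms))
    have h2 : (aeval fun i => Polynomial.C (X i : Forms)) =
        (IsScalarTower.toAlgHom ℂ Forms Forms[X]) := by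
      refine algHom_ext fun i => ?_
      simp [Polynomial.algebraMap_eq]
    rw [h2] at h1
    exact h1
  have hcoeff (G : Forms) (e : ℕ) : (θ G).coeff e = homogeneousComponent e G := by
    conv_lhs => rw [← sum_homogeneousComponent G]
    rw [map_sum, Polynomial.finsetSum_coeff]
    simp only [hθ (homogeneousComponent_isHomogeneous _ G), Polynomial.coeff_X_pow_mul',
      Polynomial.coeff_C]
    by_cases he : e ∈ Finset.range (G.totalDegree + 1)
    · rw [Finset.sum_eq_single_of_mem e he]
      · simp
      · intro b _ hb
        split_ifs with h1 h2
        · omega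
        · rfl
        · rfl
    · rw [homogeneousComponent_eq_zero e G (by simpa using he)]
      refine Finset.sum_eq_zero fun b hb => ?_
      have : b ≠ e := by rintro rfl; exact he hb
      split_ifs with h1 h2
      · omega
      · rfl
      · rfl
  have hinj (G : Forms) (hG : G ≠ 0) : θ G ≠ 0 := by
    intro h
    apply hG
    rw [← sum_homogeneousComponent G]
    exact Finset.sum_eq_zero fun e _ => by rw [← hcoeff, h, Polynomial.coeff_zero]
  have hx0 := hinj _ (left_ne_zero_of_mul h0)
  have hy0 := hinj _ (right_ne_zero_of_mul h0)
  have hmul := hθ hh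
  rw [map_mul] at hmul
  have h1 := congrArg Polynomial.natDegree hmul
  have h2 := congrArg Polynomial.natTrailingDegree hmul
  rw [Polynomial.natDegree_mul hx0 hy0, Polynomial.X_pow_mul_C,
    Polynomial.natDegree_C_mul_X_pow _ _ h0] at h1
  rw [Polynomial.natTrailingDegree_mul hx0 hy0, Polynomial.X_pow_mul_C,
    Polynomial.C_mul_X_pow_eq_monomial, Polynomial.natTrailingDegree_monomial h0] at h2
  have h3 := Polynomial.natTrailingDegree_le_natDegree (p := θ x)
  have h4 := Polynomial.natTrailingDegree_le_natDegree (p := θ y)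
  have h5 : (θ x).natTrailingDegree = (θ x).natDegree := by omega
  refine ⟨(θ x).natDegree, ?_⟩
  have h6 : x = homogeneousComponent (θ x).natDegree x := by
    conv_lhs => rw [← sum_homogeneousComponent x]
    have hz (e : ℕ) (he : e ≠ (θ x).natDegree) : homogeneousComponent e x = 0 := by
      rw [← hcoeff]
      rcases lt_or_gt_of_ne he with h | h
      · exact Polynomial.coeff_eq_zero_of_lt_natTrailingDegree (h5 ▸ h)
      · exact Polynomial.coeff_eq_zero_of_natDegree_lt h
    refine Finset.sum_eq_single _ (fun b _ hb => hz b hb) fun hb => ?_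
    exact homogeneousComponent_eq_zero _ _ (by simpa using hb)
  have h7 := homogeneousComponent_isHomogeneous (θ x).natDegree x
  rwa [← h6] at h7

theorem homogeneousComponent_mul_of_isHomogeneous {p : Forms} {d k : ℕ} (hp : p.IsHomogeneous d)
    (r : Forms) : homogeneousComponent (k + d) (r * p) = homogeneousComponent k r * p := by
  let _ : GradedAlgebra (homogeneousSubmodule (Fin 2) ℂ) := MvPolynomial.gradedAlgebra
  have := DirectSum.coe_decompose_mul_of_right_mem_of_le (homogeneousSubmodule (Fin 2) ℂ) (a := r)
    ((mem_homogeneousSubmodule d p).2 hp) (Nat.le_add_left d k)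
  rw [Nat.add_sub_cancel] at this
  have e (G : Forms) (k : ℕ) : homogeneousComponent k G =
      (DirectSum.decompose (homogeneousSubmodule (Fin 2) ℂ) G k : Forms) :=
    (decomposition.decompose'_apply G k).symm
  rw [e, e, this]

end Homogeneous

/-! ### Consequences of coprimality and birationality of the parameterization. -/

section Param

variable {n : ℕ} {φ : Fin 3 → Forms}

/-- Otherwise `φ i` would be a common divisor, hence a unit, although it vanishes at the origin. -/
theorem IsProperParam.not_proportional (hφ : IsProperParam n φ) (hn : 1 ≤ n) (i : Fin 3)
    (κ : Fin 3 → ℂ) : ¬ ∀ j, φ j = C (κ j) * φ i := by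
  intro h
  have h1 := hφ.coprime (φ i) fun j => h j ▸ dvd_mul_left _ _
  have h2 : eval (fun i => 0 * (0 : Fin 2 → ℂ) i) (φ i) = 0 := by
    rw [eval_mul_of_isHomogeneous (hφ.homogeneous i), zero_pow (by omega), zero_mul]
  have h3 := h1.map (eval (fun i => 0 * (0 : Fin 2 → ℂ) i))
  rw [h2] at h3
  exact not_isUnit_zero h3

theorem IsProperParam.exists_eval_affine_ne_zero (hφ : IsProperParam n φ) (c : ℂ) :
    ∃ i, eval ![c, 1] (φ i) ≠ 0 := by
  by_contra! h
  have h1 := hφ.coprime _ fun i => dvd_of_eval_affine_eq_zero (hφ.homogeneous i) (h i)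
  simpa using h1.map (eval ![c, 1])

theorem IsProperParam.exists_eval_infinity_ne_zero (hφ : IsProperParam n φ) :
    ∃ i, eval ![1, 0] (φ i) ≠ 0 := by
  by_contra! h
  have h1 := hφ.coprime _ fun i => dvd_of_eval_infinity_eq_zero (hφ.homogeneous i) (h i)
  simpa using h1.map (eval ![1, 0])

/-- Two families of values `β(p)`, `β(q)` orthogonal to `α(φ)` force `β(φ)` to be proportional to
`α(φ)`, because of the Koszul syzygies. -/
theorem IsMuBasis.mul_eq_mul {μ : ℕ} {p q : Fin 3 → Forms} (h : IsMuBasis n φ μ p q) {Q : Type*}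
    [CommRing Q] (α β : Forms →+* Q) (hp : ∑ k, β (p k) * α (φ k) = 0)
    (hq : ∑ k, β (q k) * α (φ k) = 0) (i j : Fin 3) :
    β (φ j) * α (φ i) = β (φ i) * α (φ j) := by
  have h1 : (Pi.single i (φ j) - Pi.single j (φ i) : Fin 3 → Forms) ∈
      Submodule.span Forms {p, q} := by
    rw [h.span_eq]
    change ∑ k, _ * φ k = 0
    simp only [Pi.sub_apply, sub_mul, Finset.sum_sub_distrib, Pi.single_apply, ite_mul, zero_mul,
      Finset.sum_ite_eq', Finset.mem_univ, if_true]
    ring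
  obtain ⟨r, s, hrs⟩ := Submodule.mem_span_pair.1 h1
  have h2 : ∑ k, β ((r • p + s • q) k) * α (φ k) = 0 := by
    simp only [Pi.add_apply, Pi.smul_apply, smul_eq_mul, map_add, map_mul, add_mul,
      Finset.sum_add_distrib, mul_assoc, ← Finset.mul_sum, hp, hq, mul_zero, add_zero]
  rw [hrs] at h2
  simp only [Pi.sub_apply, map_sub, sub_mul, Finset.sum_sub_distrib, Pi.single_apply, apply_ite β,
    map_zero, ite_mul, zero_mul, Finset.sum_ite_eq', Finset.mem_univ, if_true] at h2
  exact sub_eq_zero.1 h2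

/-- Otherwise φ(c,1) is proportional to φ modulo `π` for every `c`. Comparing with one `c₀` turns
this into identities between complex numbers, which make φ globally proportional to one of its
components. -/
theorem IsMuBasis.exists_not_dvd (h : IsProperParam n φ) (hn : 1 ≤ n) {μ : ℕ} {p q : Fin 3 → Forms}
    (hpq : IsMuBasis n φ μ p q) {π : Forms} (hπ : Prime π) :
    ∃ c : ℂ, ¬ (π ∣ ∑ k, C (eval ![c, 1] (p k)) * φ k ∧ π ∣ ∑ k, C (eval ![c, 1] (q k)) * φ k) := by
  by_contra! hc
  have key (c : ℂ) (i j : Fin 3) :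
      π ∣ C (eval ![c, 1] (φ j)) * φ i - C (eval ![c, 1] (φ i)) * φ j := by
    have := hpq.mul_eq_mul (Ideal.Quotient.mk (Ideal.span {π}))
      ((Ideal.Quotient.mk (Ideal.span {π})).comp (C.comp (eval ![c, 1])))
      (by
        simpa [← map_mul, ← map_sum, Ideal.Quotient.eq_zero_iff_dvd] using (hc c).1)
      (by
        simpa [← map_mul, ← map_sum, Ideal.Quotient.eq_zero_iff_dvd] using (hc c).2) i j
    simpa only [RingHom.comp_apply, ← map_mul, Ideal.Quotient.eq, Ideal.mem_span_singleton]
      using this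
  obtain ⟨i, hi⟩ : ∃ i, ¬ π ∣ φ i := by
    by_contra! hi
    exact hπ.not_isUnit (h.coprime π hi)
  obtain ⟨c₀, hc₀⟩ : ∃ c : ℂ, eval ![c, 1] (φ i) ≠ 0 := by
    by_contra! h0
    exact hi ((eq_zero_of_eval_affine_eq_zero (h.homogeneous i) h0) ▸ dvd_zero π)
  refine h.not_proportional hn i
    (fun j => eval ![c₀, 1] (φ j) / eval ![c₀, 1] (φ i)) fun j => ?_
  have hscal (a : ℂ) (ha : π ∣ C a * φ i) : a = 0 := by
    by_contra ha0
    exact hi (((isUnit_iff_ne_zero.2 ha0).map (C : ℂ →+* Forms)).dvd_mul_left.1 ha)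
  have hev (c : ℂ) : eval ![c, 1] (φ j) * eval ![c₀, 1] (φ i) -
      eval ![c, 1] (φ i) * eval ![c₀, 1] (φ j) = 0 := by
    apply hscal
    have e : C (eval ![c, 1] (φ j) * eval ![c₀, 1] (φ i) -
        eval ![c, 1] (φ i) * eval ![c₀, 1] (φ j)) * φ i =
        C (eval ![c₀, 1] (φ i)) * (C (eval ![c, 1] (φ j)) * φ i - C (eval ![c, 1] (φ i)) * φ j) -
        C (eval ![c, 1] (φ i)) * (C (eval ![c₀, 1] (φ j)) * φ i -
          C (eval ![c₀, 1] (φ i)) * φ j) := by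
      simp only [map_sub, map_mul]
      ring
    rw [e]
    exact dvd_sub ((key c i j).mul_left _) ((key c₀ i j).mul_left _)
  refine sub_eq_zero.1 (eq_zero_of_eval_affine_eq_zero
    ((h.homogeneous j).sub ((h.homogeneous i).C_mul _)) fun c => ?_)
  simp only [map_sub, map_mul, eval_C]
  field_simp
  linear_combination hev c

theorem IsMuBasis.leading_ne_zero (h : IsProperParam n φ) (hn : 1 ≤ n) {μ : ℕ} {p q : Fin 3 → Forms}
    (hpq : IsMuBasis n φ μ p q) :
    ∑ k, C (eval ![1, 0] (p k)) * φ k ≠ 0 ∨ ∑ k, C (eval ![1, 0] (q k)) * φ k ≠ 0 := by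
  by_contra! hc
  obtain ⟨i, hi⟩ := h.exists_eval_infinity_ne_zero
  refine h.not_proportional hn i
    (fun j => eval ![1, 0] (φ j) / eval ![1, 0] (φ i)) fun j => ?_
  have := hpq.mul_eq_mul (RingHom.id Forms) (C.comp (eval ![1, 0])) (by simpa using hc.1)
    (by simpa using hc.2) i j
  simp only [RingHom.comp_apply, RingHom.id_apply] at this
  rw [div_eq_inv_mul, map_mul, mul_assoc, this, ← mul_assoc, ← map_mul, inv_mul_cancel₀ hi, map_one,
    one_mul]

/-- The affine forms `φ_i(s, 1)` generate the unit ideal. -/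
theorem IsProperParam.exists_sum_mul_eq_one (hφ : IsProperParam n φ) :
    ∃ a : Fin 3 → ℂ[X], ∑ i, a i * aeval ![(Polynomial.X : ℂ[X]), 1] (φ i) = 1 := by
  have hev (c : ℂ) (G : Forms) :
      (aeval ![(Polynomial.X : ℂ[X]), 1] G).eval c = eval ![c, 1] G := by
    have : (Polynomial.aeval c).comp (aeval ![(Polynomial.X : ℂ[X]), 1]) = aeval ![c, 1] := by
      refine algHom_ext fun i => ?_
      fin_cases i <;> simp
    have := congrArg (fun h => h G) this
    simpa [Polynomial.coe_aeval_eq_eval] using this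
  suffices h : Ideal.span (Set.range fun i => aeval ![(Polynomial.X : ℂ[X]), 1] (φ i)) = ⊤ by
    have h1 := (Ideal.eq_top_iff_one _).1 h
    obtain ⟨a, ha⟩ := (Ideal.mem_span_range_iff_exists_fun).1 h1
    exact ⟨a, ha⟩
  by_contra h
  set I := Ideal.span (Set.range fun i => aeval ![(Polynomial.X : ℂ[X]), 1] (φ i)) with hI
  obtain ⟨d, hd⟩ := (IsPrincipalIdealRing.principal I).principal
  have hd' : I = Ideal.span {d} := hd
  have hdu : ¬ IsUnit d := fun hu => h (by rw [hd', Ideal.span_singleton_eq_top.2 hu])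
  have hdeg : d.degree ≠ 0 := fun h0 => hdu (Polynomial.isUnit_iff_degree_eq_zero.2 h0)
  obtain ⟨c, hc⟩ := IsAlgClosed.exists_root d hdeg
  obtain ⟨i, hi⟩ := hφ.exists_eval_affine_ne_zero c
  apply hi
  have h1 : aeval ![(Polynomial.X : ℂ[X]), 1] (φ i) ∈ I := Ideal.subset_span ⟨i, rfl⟩
  rw [hd', Ideal.mem_span_singleton] at h1
  rw [← hev]
  exact Polynomial.eval_eq_zero_of_dvd_of_eval_eq_zero h1 hc

/-- The generic point of the curve has a single preimage, scheme-theoretically. -/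
theorem IsMuBasis.map_X_mul_eq (h : IsProperParam n φ) (hn : 1 ≤ n) {μ : ℕ} {p q : Fin 3 → Forms}
    (hpq : IsMuBasis n φ μ p q) {Q : Type*} [CommRing Q] [Algebra ℂ Q] (α β : Forms →ₐ[ℂ] Q)
    (hp : ∑ k, β (p k) * α (φ k) = 0) (hq : ∑ k, β (q k) * α (φ k) = 0)
    (hα : ∀ x, x ≠ 0 → IsUnit (α x)) (hβ : β (X 1) = 1) : β (X 0) * α (X 1) = α (X 0) := by
  obtain ⟨i, hi⟩ : ∃ i, φ i ≠ 0 := by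
    by_contra! h0
    exact h.not_proportional hn 0 0 fun j => by simp [h0]
  obtain ⟨y, hy⟩ := (hα _ hi).exists_right_inv
  set l := β (φ i) * y with hl
  -- The Koszul syzygies force β(φ) = `l` · α(φ), with a single factor `l`.
  have hprop (j : Fin 3) : β (φ j) = l * α (φ j) := by
    have := hpq.mul_eq_mul α.toRingHom β.toRingHom hp hq i j
    change β (φ j) * α (φ i) = β (φ i) * α (φ j) at this
    rw [hl, mul_right_comm, ← this, mul_assoc, hy, mul_one]
  -- A combination of the β(φ_k) equals 1, and all of them are multiples of `l`.
  have hlu : IsUnit l := by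
    obtain ⟨a, ha⟩ := h.exists_sum_mul_eq_one
    have hcomp : (Polynomial.aeval (β (X 0))).comp (aeval ![(Polynomial.X : ℂ[X]), 1]) = β := by
      refine algHom_ext fun i => ?_
      fin_cases i
      · simp
      · simp [hβ]
    have h1 := congrArg (Polynomial.aeval (β (X 0))) ha
    rw [map_sum, map_one] at h1
    have h2 : ∑ k, Polynomial.aeval (β (X 0)) (a k) * (l * α (φ k)) = 1 := by
      rw [← h1]
      refine Finset.sum_congr rfl fun k _ => ?_
      rw [map_mul, ← hprop]
      congr 1
      exact (congrArg (fun h => h (φ k)) hcomp).symm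
    refine IsUnit.of_mul_eq_one (∑ k, Polynomial.aeval (β (X 0)) (a k) * α (φ k)) ?_
    rw [← h2, Finset.mul_sum]
    exact Finset.sum_congr rfl fun k _ => by ring
  -- The rational inverse is homogeneous, so it takes α(φ) and β(φ) to the same ratio: `l ^ e`
  -- cancels.
  obtain ⟨e, A, B, hA, hB, hAB, hinv⟩ := h.birational
  have hβG {G : MvPolynomial (Fin 3) ℂ} (hG : G.IsHomogeneous e) :
      β (aeval φ G) = l ^ e * α (aeval φ G) := by
    have h1 := aeval_mul_of_isHomogeneous hG l (fun k => α (φ k))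
    simp only [← hprop] at h1
    have h2 : β (aeval φ G) = aeval (fun k => β (φ k)) G := by
      rw [← AlgHom.comp_apply, comp_aeval]
    have h3 : α (aeval φ G) = aeval (fun k => α (φ k)) G := by
      rw [← AlgHom.comp_apply, comp_aeval]
    rw [h2, h3, h1]
  have hB0 : aeval φ B ≠ 0 := by
    intro h0
    rw [h0, mul_zero] at hinv
    exact hAB ⟨(mul_eq_zero.1 hinv).resolve_left (X_ne_zero _), h0⟩
  have h1 := congrArg β hinv
  have h2 := congrArg α hinv
  rw [map_mul, map_mul, hβ, one_mul, hβG hA, hβG hB] at h1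
  rw [map_mul, map_mul] at h2
  have h3 : α (aeval φ A) = β (X 0) * α (aeval φ B) :=
    (hlu.pow e).mul_left_cancel (by rw [h1]; ring)
  refine (hα _ hB0).mul_right_cancel ?_
  rw [← h2, h3]
  ring

end Param

/-! ### The polynomials p_φ, q_φ over ℂ[t,u] and over its fraction field. -/

section SubstForm

theorem aeval_X_one_eq (S : Type*) [CommRing S] [Algebra ℂ S] (G : Forms) :
    aeval ![(Polynomial.X : S[X]), 1] G =
      ∑ s ∈ G.support, Polynomial.monomial (s 0) (algebraMap ℂ S (G.coeff s)) := by
  rw [aeval_def, eval₂_eq']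
  refine Finset.sum_congr rfl fun s _ => ?_
  rw [Fin.prod_univ_two, ← Polynomial.C_mul_X_pow_eq_monomial]
  simp [Polynomial.algebraMap_apply]

theorem exponent_add_exponent {G : Forms} {d : ℕ} (hG : G.IsHomogeneous d) {s : Fin 2 →₀ ℕ}
    (hs : s ∈ G.support) : s 0 + s 1 = d := by
  have h := hG (mem_support_iff.1 hs)
  rw [← h, Finsupp.weight_apply, Finsupp.sum_fintype _ _ (by simp), Fin.sum_univ_two]
  simp

theorem natDegree_aeval_X_one_le (S : Type*) [CommRing S] [Algebra ℂ S] {G : Forms} {d : ℕ}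
    (hG : G.IsHomogeneous d) : (aeval ![(Polynomial.X : S[X]), 1] G).natDegree ≤ d := by
  rw [aeval_X_one_eq S G]
  refine Polynomial.natDegree_sum_le_of_forall_le _ _ fun s hs => ?_
  have := exponent_add_exponent hG hs
  exact (Polynomial.natDegree_monomial_le _).trans (by omega)

theorem coeff_aeval_X_one (S : Type*) [CommRing S] [Algebra ℂ S] {G : Forms} {d : ℕ}
    (hG : G.IsHomogeneous d) :
    (aeval ![(Polynomial.X : S[X]), 1] G).coeff d = algebraMap ℂ S (eval ![1, 0] G) := by
  rw [aeval_X_one_eq S G, Polynomial.finsetSum_coeff, eval_eq', map_sum]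
  refine Finset.sum_congr rfl fun s hs => ?_
  have := exponent_add_exponent hG hs
  rw [Polynomial.coeff_monomial, Fin.prod_univ_two]
  by_cases h1 : s 1 = 0
  · rw [if_pos (by omega)]
    simp [h1]
  · rw [if_neg (by omega)]
    simp [h1]

variable {n : ℕ} {φ : Fin 3 → Forms}

theorem natDegree_substForm_le {g : Fin 3 → Forms} {d : ℕ} (hg : ∀ i, (g i).IsHomogeneous d) :
    (substForm φ g).natDegree ≤ d := by
  refine Polynomial.natDegree_sum_le_of_forall_le _ _ fun i _ => ?_
  exact (Polynomial.natDegree_mul_C_le _ _).trans (natDegree_aeval_X_one_le Forms (hg i))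

theorem coeff_substForm {g : Fin 3 → Forms} {d : ℕ} (hg : ∀ i, (g i).IsHomogeneous d) :
    (substForm φ g).coeff d = ∑ k, C (eval ![1, 0] (g k)) * φ k := by
  rw [substForm, Polynomial.finsetSum_coeff]
  refine Finset.sum_congr rfl fun i _ => ?_
  rw [Polynomial.coeff_mul_C, coeff_aeval_X_one Forms (hg i), algebraMap_eq]

theorem eval_C_substForm (g : Fin 3 → Forms) (c : ℂ) :
    (substForm φ g).eval (C c) = ∑ k, C (eval ![c, 1] (g k)) * φ k := by
  rw [substForm, Polynomial.eval_finsetSum]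
  refine Finset.sum_congr rfl fun i _ => ?_
  rw [Polynomial.eval_mul, Polynomial.eval_C]
  congr 1
  have : ((Polynomial.aeval (C c : Forms)).restrictScalars ℂ).comp
      (aeval ![(Polynomial.X : Forms[X]), 1]) = (Algebra.ofId ℂ Forms).comp (aeval ![c, 1]) := by
    refine algHom_ext fun i => ?_
    fin_cases i <;> simp [Algebra.ofId_apply, algebraMap_eq]
  exact congrArg (fun h => h (g i)) this

/-- The fraction field of `ℂ[t,u]`. -/
abbrev FormsFrac : Type := FractionRing Forms

/-- The quotient `t / u`. -/
def ratio : FormsFrac := algebraMap Forms FormsFrac (X 0) / algebraMap Forms FormsFrac (X 1)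

theorem algebraMap_forms_ne_zero {x : Forms} (hx : x ≠ 0) : algebraMap Forms FormsFrac x ≠ 0 :=
  (map_ne_zero_iff _ (IsFractionRing.injective Forms FormsFrac)).2 hx

theorem substForm_map (g : Fin 3 → Forms) :
    (substForm φ g).map (algebraMap Forms FormsFrac) =
      ∑ k, aeval ![(Polynomial.X : FormsFrac[X]), 1] (g k) *
        Polynomial.C (algebraMap Forms FormsFrac (φ k)) := by
  have h : (Polynomial.mapAlgHom (IsScalarTower.toAlgHom ℂ Forms FormsFrac)).comp
      (aeval ![(Polynomial.X : Forms[X]), 1]) = aeval ![(Polynomial.X : FormsFrac[X]), 1] := by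
    refine algHom_ext fun i => ?_
    fin_cases i <;> simp
  rw [substForm, Polynomial.map_sum]
  refine Finset.sum_congr rfl fun k _ => ?_
  rw [Polynomial.map_mul, Polynomial.map_C]
  congr 1
  exact congrArg (fun h => h (g k)) h

/-- At (s : v) = (t : u) the form becomes the syzygy relation itself, up to a power of u. -/
theorem eval_ratio_substForm {g : Fin 3 → Forms} {d : ℕ} (hg : ∀ i, (g i).IsHomogeneous d)
    (hs : ∑ k, g k * φ k = 0) :
    ((substForm φ g).map (algebraMap Forms FormsFrac)).eval ratio = 0 := by
  have hu : algebraMap Forms FormsFrac (X 1) ≠ 0 := algebraMap_forms_ne_zero (X_ne_zero _)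
  have h1 (k : Fin 3) : algebraMap Forms FormsFrac (g k) =
      algebraMap Forms FormsFrac (X 1) ^ d *
        (aeval ![(Polynomial.X : FormsFrac[X]), 1] (g k)).eval ratio := by
    have e1 : ((Polynomial.aeval ratio).restrictScalars ℂ).comp
        (aeval ![(Polynomial.X : FormsFrac[X]), 1]) = aeval ![ratio, 1] := by
      refine algHom_ext fun i => ?_
      fin_cases i <;> simp
    have e2 : aeval (fun i => algebraMap Forms FormsFrac (X 1) * ![ratio, 1] i) =
        IsScalarTower.toAlgHom ℂ Forms FormsFrac := by
      refine algHom_ext fun i => ?_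
      fin_cases i
      · simp [ratio, mul_div_cancel₀ _ hu]
      · simp
    have e3 := aeval_mul_of_isHomogeneous (hg k) (algebraMap Forms FormsFrac (X 1)) ![ratio, 1]
    rw [e2, ← e1] at e3
    exact e3
  refine (mul_eq_zero.1 (?_ : algebraMap Forms FormsFrac (X 1) ^ d * _ = 0)).resolve_left
    (pow_ne_zero _ hu)
  rw [substForm_map, Polynomial.eval_finsetSum, Finset.mul_sum]
  simp only [Polynomial.eval_mul, Polynomial.eval_C, ← mul_assoc, ← h1, ← map_mul]
  rw [← map_sum, hs, map_zero]

end SubstForm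

/-! ### The Sylvester matrix has rank exactly n - 1. -/

section Rank

variable {n : ℕ} {φ : Fin 3 → Forms}

theorem IsMuBasis.left_mem {μ : ℕ} {p q : Fin 3 → Forms} (h : IsMuBasis n φ μ p q) :
    ∑ k, p k * φ k = 0 := by
  have : p ∈ syzygies φ := h.span_eq ▸ Submodule.subset_span (by simp)
  exact this

theorem IsMuBasis.right_mem {μ : ℕ} {p q : Fin 3 → Forms} (h : IsMuBasis n φ μ p q) :
    ∑ k, q k * φ k = 0 := by
  have : q ∈ syzygies φ := h.span_eq ▸ Submodule.subset_span (by simp)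
  exact this

theorem IsMuBasis.X_mul_sub_mem (h : IsProperParam n φ) (hn : 1 ≤ n) {μ : ℕ} {p q : Fin 3 → Forms}
    (hpq : IsMuBasis n φ μ p q) {S : Type*} [CommRing S] [Algebra ℂ S] (α β : Forms →ₐ[ℂ] S)
    (I : Ideal S) (hp : ∑ k, β (p k) * α (φ k) ∈ I) (hq : ∑ k, β (q k) * α (φ k) ∈ I)
    (hα : ∀ x, x ≠ 0 → IsUnit (α x)) (hβ : β (X 1) = 1) :
    β (X 0) * α (X 1) - α (X 0) ∈ I := by
  have hker (g : Fin 3 → Forms) (hg : ∑ k, β (g k) * α (φ k) ∈ I) :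
      ∑ k, ((Ideal.Quotient.mkₐ ℂ I).comp β) (g k) *
        ((Ideal.Quotient.mkₐ ℂ I).comp α) (φ k) = 0 := by
    simp only [AlgHom.comp_apply, ← map_mul, ← map_sum]
    exact Ideal.Quotient.eq_zero_iff_mem.2 hg
  have h1 := hpq.map_X_mul_eq h hn ((Ideal.Quotient.mkₐ ℂ I).comp α)
    ((Ideal.Quotient.mkₐ ℂ I).comp β) (hker p hp) (hker q hq)
    (fun x hx => by rw [AlgHom.comp_apply]; exact (hα x hx).map _)
    (by rw [AlgHom.comp_apply, hβ, map_one])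
  simp only [AlgHom.comp_apply, ← map_mul] at h1
  exact Ideal.Quotient.eq.1 h1

/-- The uniqueness of the preimage, applied in the quotient by the ideal (q_φ, p_φ), gives X u = t
there. -/
theorem IsMuBasis.X_sub_C_ratio_mem (h : IsProperParam n φ) (hn : 1 ≤ n) {μ : ℕ}
    {p q : Fin 3 → Forms} (hpq : IsMuBasis n φ μ p q) :
    Polynomial.X - Polynomial.C ratio ∈
      Ideal.span {(substForm φ q).map (algebraMap Forms FormsFrac),
        (substForm φ p).map (algebraMap Forms FormsFrac)} := by
  have hα (x : Forms) : IsScalarTower.toAlgHom ℂ Forms FormsFrac[X] x =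
      Polynomial.C (algebraMap Forms FormsFrac x) := by
    rw [IsScalarTower.coe_toAlgHom', Polynomial.algebraMap_apply]
  have hu : algebraMap Forms FormsFrac (X 1) ≠ 0 := algebraMap_forms_ne_zero (X_ne_zero _)
  generalize hI : Ideal.span {(substForm φ q).map (algebraMap Forms FormsFrac),
        (substForm φ p).map (algebraMap Forms FormsFrac)} = I
  have hp : (substForm φ p).map (algebraMap Forms FormsFrac) ∈ I :=
    hI ▸ Ideal.subset_span (by simp)
  have hq : (substForm φ q).map (algebraMap Forms FormsFrac) ∈ I :=
    hI ▸ Ideal.subset_span (by simp)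
  rw [substForm_map] at hp hq
  simp only [← hα] at hp hq
  have h1 := hpq.X_mul_sub_mem h hn (IsScalarTower.toAlgHom ℂ Forms FormsFrac[X])
    (aeval ![(Polynomial.X : FormsFrac[X]), 1]) I hp hq
    (fun x hx => by
      rw [hα]
      exact (isUnit_iff_ne_zero.2 (algebraMap_forms_ne_zero hx)).map Polynomial.C)
    (by simp)
  rw [hα, hα, aeval_X] at h1
  have h2 := I.mul_mem_right (Polynomial.C (algebraMap Forms FormsFrac (X 1))⁻¹) h1
  have h3 : Polynomial.C (algebraMap Forms FormsFrac (X 1)) *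
      Polynomial.C (algebraMap Forms FormsFrac (X 1))⁻¹ = 1 := by
    rw [← map_mul, mul_inv_cancel₀ hu, map_one]
  rw [sub_mul, mul_assoc, h3, ← map_mul, ← div_eq_mul_inv, mul_one] at h2
  exact h2

theorem substForm_eq_zero_of_isHomogeneous_zero {g : Fin 3 → Forms}
    (hg : ∀ i, (g i).IsHomogeneous 0) (hs : ∑ k, g k * φ k = 0) : substForm φ g = 0 := by
  have h (i : Fin 3) : g i = C (coeff 0 (g i)) := by
    rw [← totalDegree_eq_zero_iff_eq_C]
    exact Nat.le_zero.1 (hg i).totalDegree_le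
  have h2 : substForm φ g = Polynomial.C (∑ k, g k * φ k) := by
    rw [substForm, map_sum]
    refine Finset.sum_congr rfl fun k _ => ?_
    rw [map_mul]
    congr 1
    rw [h k]
    simp [Polynomial.algebraMap_apply, algebraMap_eq]
  rw [h2, hs, map_zero]

theorem IsMuBasis.leading_coeff_ne_zero (h : IsProperParam n φ) (hn : 1 ≤ n) {μ : ℕ}
    {p q : Fin 3 → Forms} (hpq : IsMuBasis n φ μ p q) :
    (substForm φ q).coeff (n - μ) ≠ 0 ∨ (substForm φ p).coeff μ ≠ 0 := by
  rw [coeff_substForm hpq.homogeneous_left, coeff_substForm hpq.homogeneous_right]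
  exact (hpq.leading_ne_zero h hn).symm

/-- A syzygy of degree 0 makes p_φ vanish; then q_φ, of exact degree `n`, would divide the linear
polynomial X - t/u. -/
theorem IsMuBasis.one_le (h : IsProperParam n φ) (hn : 3 ≤ n) {μ : ℕ}
    {p q : Fin 3 → Forms} (hpq : IsMuBasis n φ μ p q) : 1 ≤ μ := by
  by_contra hμ
  obtain rfl : μ = 0 := by omega
  have h0 := substForm_eq_zero_of_isHomogeneous_zero hpq.homogeneous_left hpq.left_mem
  have h1 := hpq.X_sub_C_ratio_mem h (by omega)
  have h2 : (substForm φ q).coeff n ≠ 0 := by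
    simpa [h0] using hpq.leading_coeff_ne_zero h (by omega)
  rw [h0, Polynomial.map_zero, Ideal.span_pair_zero, Ideal.mem_span_singleton] at h1
  have h3 := Polynomial.natDegree_le_of_dvd h1 (Polynomial.X_sub_C_ne_zero _)
  rw [Polynomial.natDegree_X_sub_C] at h3
  have h4 := Polynomial.le_natDegree_of_ne_zero (p := (substForm φ q).map
    (algebraMap Forms FormsFrac)) (n := n)
    (by rw [Polynomial.coeff_map]; exact algebraMap_forms_ne_zero h2)
  omega

/-- Reducing the cofactor of `f` modulo `g` bounds its degree; comparing degrees in `v g = h - u f`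
bounds `v`. -/
theorem exists_mul_add_mul_eq_of_isCoprime {K : Type*} [Field K] {f g : K[X]} (hfg : IsCoprime f g)
    {a b : ℕ} (hf : f.natDegree ≤ a) (hg : g.natDegree = b) (hg0 : g ≠ 0) {h : K[X]}
    (hh : h.natDegree ≤ a + b) :
    ∃ u ∈ Polynomial.degreeLT K (b + 1), ∃ v ∈ Polynomial.degreeLT K (a + 1),
      u * f + v * g = h := by
  obtain ⟨r, s, hrs⟩ := hfg
  set u := (h * r) % g with hu
  have hud : u ∈ Polynomial.degreeLT K (b + 1) := by
    rw [Polynomial.mem_degreeLT]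
    refine (EuclideanDomain.mod_lt (h * r) hg0).trans ?_
    rw [Polynomial.degree_eq_natDegree hg0, hg]
    exact_mod_cast Nat.lt_succ_self b
  have hdvd : g ∣ h - u * f := by
    have h1 : h * r = g * ((h * r) / g) + u := (EuclideanDomain.div_add_mod _ _).symm
    refine ⟨h * s + f * (h * r / g), ?_⟩
    linear_combination -h * hrs + f * h1
  obtain ⟨v, hv⟩ := hdvd
  refine ⟨u, hud, v, ?_, by linear_combination -hv⟩
  by_cases hv0 : v = 0
  · simp [hv0]
  apply mem_degreeLT_of_natDegree_lt
  have h2 := Polynomial.natDegree_mul hg0 hv0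
  rw [← hv, hg] at h2
  have hun : u.natDegree ≤ b := by
    rw [Polynomial.mem_degreeLT] at hud
    exact Nat.lt_succ_iff.1 (by
      by_cases hu0 : u = 0
      · simp [hu0]
      · exact (Polynomial.natDegree_lt_iff_degree_lt hu0).2 hud)
  have h3 := Polynomial.natDegree_sub_le_of_le hh (Polynomial.natDegree_mul_le_of_le hun hf)
  omega

/-- If two polynomials over a field have a single common zero `θ`, then the image of the Sylvester
map consists of the multiples of `X - θ`. -/
theorem hybridSpan_zero_eq {K : Type*} [Field K] {n m : ℕ} (hm : 1 ≤ m) (hn : 1 ≤ n) (hmn : m ≤ n)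
    {f g : K[X]} {θ : K}
    (hf : f.natDegree ≤ n) (hg : g.natDegree ≤ m) (hlead : f.coeff n ≠ 0 ∨ g.coeff m ≠ 0)
    (hfθ : f.eval θ = 0) (hgθ : g.eval θ = 0)
    (hmem : Polynomial.X - Polynomial.C θ ∈ Ideal.span {f, g}) :
    hybridSpan n m 0 f g = Submodule.span K (Set.range fun i : Fin (m + n - 1) =>
      (Polynomial.X - Polynomial.C θ) * Polynomial.X ^ (i : ℕ)) := by
  have hX0 := Polynomial.X_sub_C_ne_zero θ
  apply le_antisymm
  · intro w hw
    have hroot : hybridSpan n m 0 f g ≤ LinearMap.ker (Polynomial.leval θ) := by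
      refine hybridSpan_le (Nat.zero_le _) (fun e h1 h2 => by omega) (fun l _ => ?_) fun l _ => ?_
      · simp [Polynomial.leval, hfθ]
      · simp [Polynomial.leval, hgθ]
    obtain ⟨w', rfl⟩ := Polynomial.dvd_iff_isRoot.2 (hroot hw)
    have h1 := hybridSpan_le_degreeLT hmn (Nat.zero_le _) hf hg hw
    have h2 : w' ∈ Polynomial.degreeLT K (m + n - 1) := mem_degreeLT_of_X_sub_C_mul_mem
      (by convert h1 using 2; omega)
    rw [mul_comm]
    refine mul_mem_of_mem_degreeLT h2 fun l hl => Submodule.subset_span ⟨⟨l, hl⟩, mul_comm _ _⟩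
  · refine Submodule.span_le.2 ?_
    rintro _ ⟨i, rfl⟩
    change _ ∈ hybridSpan n m 0 f g
    obtain ⟨f', hf'⟩ := Polynomial.dvd_iff_isRoot.2 hfθ
    obtain ⟨g', hg'⟩ := Polynomial.dvd_iff_isRoot.2 hgθ
    have hcop : IsCoprime f' g' := by
      obtain ⟨a, b, hab⟩ := Ideal.mem_span_pair.1 hmem
      refine ⟨a, b, mul_left_cancel₀ hX0 ?_⟩
      rw [mul_one]
      refine Eq.trans ?_ hab
      rw [hf', hg']
      ring
    have hdeg {d : ℕ} {w w' : K[X]} (hw : w.natDegree ≤ d)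
        (h : w = (Polynomial.X - Polynomial.C θ) * w')
        (hd : 1 ≤ d) : w'.natDegree ≤ d - 1 := by
      by_cases h0 : w' = 0
      · simp [h0]
      have := Polynomial.natDegree_mul hX0 h0
      rw [← h, Polynomial.natDegree_X_sub_C] at this
      omega
    have hdeg' {d : ℕ} {w w' : K[X]} (hw : w.natDegree ≤ d)
        (h : w = (Polynomial.X - Polynomial.C θ) * w')
        (hd : 1 ≤ d) (h1 : w.coeff d ≠ 0) : w'.natDegree = d - 1 ∧ w' ≠ 0 := by
      have h2 := Polynomial.le_natDegree_of_ne_zero h1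
      have h0 : w' ≠ 0 := by
        rintro rfl
        rw [h] at h1
        simp at h1
      have := Polynomial.natDegree_mul hX0 h0
      rw [← h, Polynomial.natDegree_X_sub_C] at this
      exact ⟨by omega, h0⟩
    have hXi : ((Polynomial.X : K[X]) ^ (i : ℕ)).natDegree ≤ n - 1 + (m - 1) := by
      rw [Polynomial.natDegree_X_pow]
      omega
    -- The reduction is made modulo whichever of `f'`, `g'` has its full degree, as guaranteed by
    -- `hlead`.
    have key : ∃ u ∈ Polynomial.degreeLT K (m - 1 + 1), ∃ v ∈ Polynomial.degreeLT K (n - 1 + 1),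
        u * f' + v * g' = Polynomial.X ^ (i : ℕ) := by
      rcases hlead with hl | hl
      · obtain ⟨h1, h2⟩ := hdeg' hf hf' hn hl
        obtain ⟨v, hv, u, hu, huv⟩ := exists_mul_add_mul_eq_of_isCoprime hcop.symm
          (hdeg hg hg' hm) h1 h2 (by rwa [add_comm])
        exact ⟨u, hu, v, hv, by rw [← huv, add_comm]⟩
      · obtain ⟨h1, h2⟩ := hdeg' hg hg' hm hl
        exact exists_mul_add_mul_eq_of_isCoprime hcop (hdeg hf hf' hn) h1 h2 hXi
    obtain ⟨u, hu, v, hv, huv⟩ := key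
    rw [Nat.sub_add_cancel hm] at hu
    rw [Nat.sub_add_cancel hn] at hv
    have e : (Polynomial.X - Polynomial.C θ) * Polynomial.X ^ (i : ℕ) = u * f + v * g := by
      rw [← huv, hf', hg']
      ring
    simp only
    rw [e]
    exact Submodule.add_mem _
      (mul_mem_of_mem_degreeLT hu fun l hl => X_pow_mul_left_mem_hybridSpan f g hl)
      (mul_mem_of_mem_degreeLT hv fun l hl => X_pow_mul_right_mem_hybridSpan f g hl)

/-- Deleting the row of constant coefficients leaves an upper triangular matrix with 1 on the
diagonal. -/
theorem minorIdeal_X_sub_C_mul_X_pow {A : Type*} [CommRing A] (θ : A) (L : ℕ) :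
    minorIdeal (coeffMatrix (L + 1) fun i : Fin L =>
      (Polynomial.X - Polynomial.C θ) * Polynomial.X ^ (i : ℕ)) L = ⊤ := by
  rw [Ideal.eq_top_iff_one]
  have h := det_submatrix_mem_minorIdeal (coeffMatrix (L + 1) fun i : Fin L =>
      (Polynomial.X - Polynomial.C θ) * Polynomial.X ^ (i : ℕ)) Fin.succ id
  have hentry (i j : Fin L) : ((coeffMatrix (L + 1) fun i : Fin L =>
      (Polynomial.X - Polynomial.C θ) * Polynomial.X ^ (i : ℕ)).submatrix Fin.succ id) i j =
      (if (i : ℕ) = j then 1 else 0) - θ * (if (i : ℕ) + 1 = j then 1 else 0) := by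
    simp [coeffMatrix, sub_mul, Polynomial.coeff_X_pow, ← pow_succ']
  rw [Matrix.det_of_isUpperTriangular, Finset.prod_eq_one] at h
  · exact h
  · intro i _
    rw [hentry]
    simp
  · intro i j hij
    have : (j : ℕ) < i := hij
    rw [hentry, if_neg (by omega), if_neg (by omega)]
    simp

theorem minorIdeal_eq_bot_of_card_lt {A : Type*} [CommRing A] {r c : Type*} [Fintype c]
    (M : Matrix r c A) {k : ℕ} (h : Fintype.card c < k) : minorIdeal M k = ⊥ := by
  rw [eq_bot_iff]
  refine minorIdeal_le fun f g => ?_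
  have := Fintype.card_le_of_embedding g
  rw [Fintype.card_fin] at this
  omega

theorem IsMuBasis.minorIdeal_sylvester (h : IsProperParam n φ) (hn : 3 ≤ n) {μ : ℕ}
    {p q : Fin 3 → Forms} (hpq : IsMuBasis n φ μ p q) :
    minorIdeal (psi n φ μ p q 0) (n - 1) ≠ ⊥ ∧ minorIdeal (psi n φ μ p q 0) n = ⊥ := by
  have hμ := hpq.one_le h hn
  have hle := hpq.le
  have hf := natDegree_substForm_le (φ := φ) hpq.homogeneous_right
  have hg := natDegree_substForm_le (φ := φ) hpq.homogeneous_left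
  have hinj := IsFractionRing.injective Forms FormsFrac
  have hspan := hybridSpan_zero_eq (θ := ratio) hμ (by omega) hle
    (f := (substForm φ q).map (algebraMap Forms FormsFrac))
    (g := (substForm φ p).map (algebraMap Forms FormsFrac))
    (Polynomial.natDegree_map_le.trans hf) (Polynomial.natDegree_map_le.trans hg)
    (by
      rw [Polynomial.coeff_map, Polynomial.coeff_map]
      exact (hpq.leading_coeff_ne_zero h (by omega)).imp algebraMap_forms_ne_zero
        algebraMap_forms_ne_zero)
    (eval_ratio_substForm hpq.homogeneous_right hpq.right_mem)
    (eval_ratio_substForm hpq.homogeneous_left hpq.left_mem)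
    (hpq.X_sub_C_ratio_mem h (by omega))
  have hL : μ + (n - μ) - 1 = n - 1 := by omega
  have hL' : μ + (n - μ) - 0 = n - 1 + 1 := by omega
  have hmap (k : ℕ) : minorIdeal (hybridMatrix (n - μ) μ 0
      ((substForm φ q).map (algebraMap Forms FormsFrac))
      ((substForm φ p).map (algebraMap Forms FormsFrac))) k =
      Ideal.map (algebraMap Forms FormsFrac) (minorIdeal (psi n φ μ p q 0) k) := by
    rw [hybridMatrix_map, minorIdeal_map, minorIdeal, Ideal.map_span]
    rfl
  have hmin (k : ℕ) : minorIdeal (hybridMatrix (n - μ) μ 0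
      ((substForm φ q).map (algebraMap Forms FormsFrac))
      ((substForm φ p).map (algebraMap Forms FormsFrac))) k =
      minorIdeal (coeffMatrix (n - 1 + 1) fun i : Fin (n - 1) =>
        (Polynomial.X - Polynomial.C ratio) * Polynomial.X ^ (i : ℕ)) k := by
    rw [hL] at hspan
    rw [← hL']
    apply le_antisymm
    · exact minorIdeal_coeffMatrix_mono _ _ fun i =>
        hspan.le (Submodule.subset_span ⟨i, rfl⟩)
    · exact minorIdeal_coeffMatrix_mono _ _ fun i =>
        hspan.ge (Submodule.subset_span ⟨i, rfl⟩)
  constructor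
  · intro h0
    have := hmap (n - 1)
    rw [h0, Ideal.map_bot, hmin, minorIdeal_X_sub_C_mul_X_pow] at this
    exact top_ne_bot this
  · have := hmap n
    rw [hmin, minorIdeal_eq_bot_of_card_lt _ (by rw [Fintype.card_fin]; omega)] at this
    exact (Ideal.map_eq_bot_iff_of_injective hinj).1 this.symm

end Rank

/-! ### Independence of the μ-basis and of j. -/

section Independence

variable {n : ℕ} {φ : Fin 3 → Forms}

theorem substForm_add_smul (r s : Forms) (p q : Fin 3 → Forms) :
    substForm φ (r • p + s • q) =
      aeval ![(Polynomial.X : Forms[X]), 1] r * substForm φ p +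
        aeval ![(Polynomial.X : Forms[X]), 1] s * substForm φ q := by
  simp only [substForm, Finset.mul_sum, ← Finset.sum_add_distrib]
  refine Finset.sum_congr rfl fun k _ => ?_
  simp only [Pi.add_apply, Pi.smul_apply, smul_eq_mul, map_add, map_mul]
  ring

/-- In `r p + s q` only the components of `r`, `s` of degrees n - 1 - μ and μ - 1 matter, and these
are exactly the multipliers allowed in the Sylvester map. -/
theorem IsMuBasis.substForm_mem_hybridSpan {μ : ℕ} {p q : Fin 3 → Forms}
    (hpq : IsMuBasis n φ μ p q) (hμ : 1 ≤ μ) {g : Fin 3 → Forms} (hg : g ∈ syzygies φ)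
    (hgn : ∀ i, (g i).IsHomogeneous (n - 1)) :
    substForm φ g ∈ hybridSpan (n - μ) μ 0 (substForm φ q) (substForm φ p) := by
  have hle := hpq.le
  rw [← hpq.span_eq] at hg
  obtain ⟨r, s, rfl⟩ := Submodule.mem_span_pair.1 hg
  have heq : r • p + s • q =
      homogeneousComponent (n - 1 - μ) r • p + homogeneousComponent (μ - 1) s • q := by
    funext k
    have h1 := homogeneousComponent_mul_of_isHomogeneous (k := n - 1 - μ)
      (hpq.homogeneous_left k) r
    have h2 := homogeneousComponent_mul_of_isHomogeneous (k := μ - 1)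
      (hpq.homogeneous_right k) s
    rw [show n - 1 - μ + μ = n - 1 by omega] at h1
    rw [show μ - 1 + (n - μ) = n - 1 by omega] at h2
    have h3 := homogeneousComponent_of_mem (m := n - 1)
      ((mem_homogeneousSubmodule _ _).2 (hgn k))
    rw [if_pos rfl] at h3
    rw [← h3]
    simp only [Pi.add_apply, Pi.smul_apply, smul_eq_mul, map_add, h1, h2]
  rw [heq, substForm_add_smul]
  have d1 := natDegree_aeval_X_one_le Forms (homogeneousComponent_isHomogeneous (n - 1 - μ) r)
  have d2 := natDegree_aeval_X_one_le Forms (homogeneousComponent_isHomogeneous (μ - 1) s)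
  exact Submodule.add_mem _
    (mul_mem_of_mem_degreeLT (mem_degreeLT_of_natDegree_lt (d := n - μ) (by omega))
      fun l hl => X_pow_mul_right_mem_hybridSpan _ _ hl)
    (mul_mem_of_mem_degreeLT (mem_degreeLT_of_natDegree_lt (d := μ) (by omega))
      fun l hl => X_pow_mul_left_mem_hybridSpan _ _ hl)

theorem X_pow_mul_substForm_eq (g : Fin 3 → Forms) (l k : ℕ) :
    Polynomial.X ^ l * substForm φ g = substForm φ ((X 0 ^ l * X 1 ^ k : Forms) • g) := by
  have := substForm_add_smul (φ := φ) (X 0 ^ l * X 1 ^ k) 0 g 0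
  rw [zero_smul, add_zero] at this
  rw [this]
  simp

/-- Each column of the second Sylvester matrix comes from a syzygy of degree n - 1, after
multiplication by a suitable power of v, invisible at v = 1. -/
theorem IsMuBasis.hybridSpan_le_hybridSpan {μ ν : ℕ} {p q p' q' : Fin 3 → Forms}
    (hpq : IsMuBasis n φ μ p q) (hpq' : IsMuBasis n φ ν p' q') (hμ : 1 ≤ μ) (hν : 1 ≤ ν) :
    hybridSpan (n - ν) ν 0 (substForm φ q') (substForm φ p') ≤
      hybridSpan (n - μ) μ 0 (substForm φ q) (substForm φ p) := by
  have hle := hpq'.le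
  have hmono {g : Fin 3 → Forms} {d : ℕ} (hg : g ∈ syzygies φ) (hgd : ∀ i, (g i).IsHomogeneous d)
      {l : ℕ} (hl : l + d ≤ n - 1) : Polynomial.X ^ l * substForm φ g ∈
        hybridSpan (n - μ) μ 0 (substForm φ q) (substForm φ p) := by
    rw [X_pow_mul_substForm_eq g l (n - 1 - (l + d))]
    refine hpq.substForm_mem_hybridSpan hμ (Submodule.smul_mem _ _ hg) fun i => ?_
    have := ((isHomogeneous_X_pow (R := ℂ) (0 : Fin 2) l).mul
      (isHomogeneous_X_pow (R := ℂ) (1 : Fin 2) (n - 1 - (l + d)))).mul (hgd i)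
    rwa [show l + (n - 1 - (l + d)) + d = n - 1 by omega] at this
  exact hybridSpan_le (Nat.zero_le _) (fun e h1 h2 => by omega)
    (fun l hl => hmono hpq'.right_mem hpq'.homogeneous_right (by omega))
    (fun l hl => hmono hpq'.left_mem hpq'.homogeneous_left (by omega))

theorem IsMuBasis.minorIdeal_psi_zero_eq {μ ν : ℕ} {p q p' q' : Fin 3 → Forms}
    (hpq : IsMuBasis n φ μ p q) (hpq' : IsMuBasis n φ ν p' q') (hμ : 1 ≤ μ) (hν : 1 ≤ ν) (k : ℕ) :
    minorIdeal (psi n φ μ p q 0) k = minorIdeal (psi n φ ν p' q' 0) k := by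
  have hle := hpq.le
  have hle' := hpq'.le
  have e : μ + (n - μ) - 0 = n := by omega
  have e' : ν + (n - ν) - 0 = n := by omega
  change minorIdeal (coeffMatrix (μ + (n - μ) - 0) _) k =
    minorIdeal (coeffMatrix (ν + (n - ν) - 0) _) k
  rw [e, e']
  apply le_antisymm
  · exact minorIdeal_coeffMatrix_mono _ _ fun i =>
      hpq'.hybridSpan_le_hybridSpan hpq hν hμ (Submodule.subset_span ⟨i, rfl⟩)
  · exact minorIdeal_coeffMatrix_mono _ _ fun i =>
      hpq.hybridSpan_le_hybridSpan hpq' hμ hν (Submodule.subset_span ⟨i, rfl⟩)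

theorem IsMuBasis.associated_isGCDOf_psi_succ (h : IsProperParam n φ) (hn : 1 ≤ n) {μ : ℕ}
    {p q : Fin 3 → Forms} (hpq : IsMuBasis n φ μ p q) {j : ℕ} (hj : j < μ) {k : ℕ} {x y : Forms}
    (hx : IsGCDOf (minors (psi n φ μ p q j) (k + 1)) x)
    (hy : IsGCDOf (minors (psi n φ μ p q (j + 1)) k) y) : Associated x y := by
  refine associated_of_forall_atPrime exists_prime_forms hx hy fun π hπ _ => ?_
  obtain ⟨c, hc⟩ := hpq.exists_not_dvd h hn hπ
  simp only [← eval_C_substForm] at hc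
  rw [← minorIdeal_map, ← minorIdeal_map, psi, psi, ← hybridMatrix_map, ← hybridMatrix_map]
  set A := Localization.AtPrime (Ideal.span {π})
  have huv : ∃ u v : A,
      u * ((substForm φ q).map (algebraMap Forms A)).eval (algebraMap Forms A (C c))
      + v * ((substForm φ p).map (algebraMap Forms A)).eval (algebraMap Forms A (C c)) = 1 := by
    simp only [Polynomial.eval_map_apply]
    rcases not_and_or.1 hc with h1 | h1
    · obtain ⟨v, hv⟩ := (isUnit_algebraMap_atPrime h1).exists_left_inv
      exact ⟨0, v, by rw [zero_mul, zero_add, hv]⟩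
    · obtain ⟨u, hu⟩ := (isUnit_algebraMap_atPrime h1).exists_left_inv
      exact ⟨u, 0, by rw [zero_mul, add_zero, hu]⟩
  obtain ⟨u, v, huv⟩ := huv
  exact minorIdeal_hybridMatrix_succ hj hpq.le
    (Polynomial.natDegree_map_le.trans (natDegree_substForm_le hpq.homogeneous_right))
    (Polynomial.natDegree_map_le.trans (natDegree_substForm_le hpq.homogeneous_left)) huv k

/-- The greatest common divisors of the minors of all the matrices `ψ_j` form a single sequence. -/
theorem exists_isGCDOf_minors_psi (h : IsProperParam n φ) (hn : 3 ≤ n) :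
    ∃ G : ℕ → Forms, ∀ (μ : ℕ) (p q : Fin 3 → Forms), IsMuBasis n φ μ p q →
      ∀ j ≤ μ, ∀ k, IsGCDOf (minors (psi n φ μ p q j) k) (G (k + j)) := by
  by_cases hex : ∃ (ν : ℕ) (p' q' : Fin 3 → Forms), IsMuBasis n φ ν p' q'
  swap
  · exact ⟨0, fun μ p q hpq => absurd ⟨μ, p, q, hpq⟩ hex⟩
  obtain ⟨ν, p', q', hpq'⟩ := hex
  choose G hG using fun k => exists_isGCDOf (finite_minors (psi n φ ν p' q' 0) k)
  refine ⟨G, fun μ p q hpq j => ?_⟩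
  induction j with
  | zero =>
    intro _ k
    exact isGCDOf_of_span_eq
      (hpq'.minorIdeal_psi_zero_eq hpq (hpq'.one_le h hn) (hpq.one_le h hn) k) (hG k)
  | succ j ih =>
    intro hj k
    obtain ⟨x, hx⟩ := exists_isGCDOf (finite_minors (psi n φ μ p q (j + 1)) k)
    have h1 := ih (by omega) (k + 1)
    have h2 := hpq.associated_isGCDOf_psi_succ h (by omega) hj h1 hx
    rw [show k + (j + 1) = k + 1 + j by ring]
    exact hx.congr h2.symm

end Independence

/-! ### Homogeneity of the minors. -/

section Homogeneity

variable {n : ℕ} {φ : Fin 3 → Forms}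

theorem det_isHomogeneous {ι : Type*} [Fintype ι] [DecidableEq ι] {M : Matrix ι ι Forms} {d : ι → ℕ}
    (h : ∀ i j, (M i j).IsHomogeneous (d j)) : M.det.IsHomogeneous (∑ j, d j) := by
  rw [Matrix.det_apply]
  refine IsHomogeneous.sum _ _ _ fun σ _ => ?_
  have h1 := IsHomogeneous.prod Finset.univ (fun i => M (σ i) i) d fun i _ => h (σ i) i
  rw [Units.smul_def, zsmul_eq_mul, ← map_intCast (C : ℂ →+* Forms)]
  exact h1.C_mul _

theorem coeff_substForm_isHomogeneous (hφ : IsProperParam n φ) (g : Fin 3 → Forms) (l : ℕ) :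
    ((substForm φ g).coeff l).IsHomogeneous n := by
  rw [substForm, Polynomial.finsetSum_coeff]
  refine IsHomogeneous.sum _ _ _ fun i _ => ?_
  rw [Polynomial.coeff_mul_C, aeval_X_one_eq Forms, Polynomial.finsetSum_coeff, ← zero_add n]
  refine IsHomogeneous.mul (IsHomogeneous.sum _ _ _ fun s _ => ?_) (hφ.homogeneous i)
  rw [Polynomial.coeff_monomial]
  split_ifs
  · exact isHomogeneous_C _ _
  · exact isHomogeneous_zero _ _ _

/-- The minors of the Sylvester matrix are homogeneous. -/
theorem exists_isHomogeneous_of_mem_minors (hφ : IsProperParam n φ) {μ k : ℕ} {p q : Fin 3 → Forms}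
    {x : Forms} (hx : x ∈ minors (psi n φ μ p q 0) k) : ∃ e, x.IsHomogeneous e := by
  obtain ⟨f, g, rfl⟩ := hx
  have hX (w : Fin 3 → Forms) (l r : ℕ) :
      ((Polynomial.X ^ l * substForm φ w).coeff r).IsHomogeneous n := by
    rw [Polynomial.coeff_X_pow_mul']
    split_ifs
    · exact coeff_substForm_isHomogeneous hφ w _
    · exact isHomogeneous_zero _ _ _
  have hentry (r : Fin (μ + (n - μ) - 0)) (s : Fin 0 ⊕ (Fin (μ - 0) ⊕ Fin (n - μ - 0))) :
      (psi n φ μ p q 0 r s).IsHomogeneous n := by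
    rcases s with a | a | a
    · exact a.elim0
    · exact hX q a r
    · exact hX p a r
  generalize psi n φ μ p q 0 = M at hentry
  exact ⟨_, det_isHomogeneous (d := fun _ => n) fun i j => hentry (f i) (g j)⟩

end Homogeneity

/-! ### From log-convex sequences of gcds to singular factors, and uniqueness. -/

section SingularFactors

/-- A log-convex sequence is a sequence of products of singular factors. -/
theorem exists_prod_eq_of_sq_dvd {G : ℕ → Forms} {n : ℕ} (h0 : IsUnit (G 0))
    (hne : ∀ k < n, G k ≠ 0) (hdvd : ∀ k, G (k + 1) ^ 2 ∣ G (k + 2) * G k) :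
    ∃ c : ℕ → Forms, Associated (c 0) (G 1) ∧
      (∀ k, G (k + 2) * G k = G (k + 1) ^ 2 * c (k + 1)) ∧
      ∀ k ≤ n, Associated (G k) (∏ i ∈ Finset.range k, c i ^ (k - i)) := by
  choose c₁ hc₁ using hdvd
  obtain ⟨c', hc', hc⟩ : ∃ c' : ℕ → Forms, c' 0 = G 1 ∧
      ∀ k, G (k + 2) * G k = G (k + 1) ^ 2 * c' (k + 1) :=
    ⟨fun k => if k = 0 then G 1 else c₁ (k - 1), if_pos rfl, fun k => by simpa using hc₁ k⟩
  refine ⟨c', hc' ▸ Associated.refl _, hc, ?_⟩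
  -- The recurrence has order two, hence the induction on consecutive pairs. Only `G k` with `k < n`
  -- is cancelled, so `G n` may be zero.
  have key (k : ℕ) : (k ≤ n → Associated (G k) (∏ i ∈ Finset.range k, c' i ^ (k - i))) ∧
      (k + 1 ≤ n → Associated (G (k + 1)) (∏ i ∈ Finset.range (k + 1), c' i ^ (k + 1 - i))) := by
    induction k with
    | zero => exact ⟨fun _ => by simpa [associated_one_iff_isUnit] using h0, fun _ => by simp [hc']⟩
    | succ k ih =>
      refine ⟨ih.2, fun hk => ?_⟩
      have h1 := ih.1 (by omega)
      have h2 := ih.2 (by omega)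
      have h3 := prod_pow_sub_mul c' k
      have h4 : Associated (G (k + 2) * G k)
          ((∏ i ∈ Finset.range (k + 2), c' i ^ (k + 2 - i)) *
            ∏ i ∈ Finset.range k, c' i ^ (k - i)) := by
        rw [h3, hc, mul_comm]
        exact (h2.pow_pow).mul_left _
      exact h4.of_mul_right h1 (hne k (by omega))
  exact fun k => (key k).1

theorem prod_Icc_eq_prod_range (d : ℕ → Forms) {n i : ℕ} (hin : i ≤ n) :
    ∏ k ∈ Finset.Icc i n, d k ^ (k - i + 1) =
      ∏ l ∈ Finset.range (n + 1 - i), d (n - l) ^ (n + 1 - i - l) := by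
  refine Finset.prod_bij' (fun k _ => n - k) (fun l _ => n - l) ?_ ?_ ?_ ?_ ?_
  · intro k hk
    have := Finset.mem_Icc.1 hk
    exact Finset.mem_range.2 (by omega)
  · intro l hl
    have := Finset.mem_range.1 hl
    exact Finset.mem_Icc.2 (by omega)
  · intro k hk
    have := Finset.mem_Icc.1 hk
    omega
  · intro l hl
    have := Finset.mem_range.1 hl
    omega
  · intro k hk
    have := Finset.mem_Icc.1 hk
    rw [show n - (n - k) = k by omega]
    congr 1
    omega

/-- Descending induction on `i`, cancelling the factors of index greater than `i`. Their indices are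
at least 2, so `d 1` is allowed to vanish. -/
theorem associated_of_prod_Icc_associated {d e : ℕ → Forms} {N : ℕ}
    (hd : ∀ i, 2 ≤ i → i ≤ N → d i ≠ 0)
    (h : ∀ i, 1 ≤ i → i ≤ N → Associated (∏ k ∈ Finset.Icc i N, e k ^ (k - i + 1))
      (∏ k ∈ Finset.Icc i N, d k ^ (k - i + 1))) (i : ℕ) (hi : 1 ≤ i) (hiN : i ≤ N) :
    Associated (e i) (d i) := by
  obtain ⟨l, hl⟩ : ∃ l, l + i = N := ⟨N - i, by omega⟩
  induction l using Nat.strong_induction_on generalizing i with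
  | _ l ih =>
    have hsplit (a : ℕ → Forms) : ∏ k ∈ Finset.Icc i N, a k ^ (k - i + 1) =
        a i * ∏ k ∈ Finset.Icc (i + 1) N, a k ^ (k - i + 1) := by
      rw [← Finset.insert_Icc_add_one_left_eq_Icc hiN, Finset.prod_insert (by simp)]
      simp
    have h1 := h i hi hiN
    rw [hsplit, hsplit] at h1
    have h2 (k : ℕ) (hk : k ∈ Finset.Icc (i + 1) N) : Associated (e k) (d k) := by
      have := Finset.mem_Icc.1 hk
      exact ih (N - k) (by omega) k (by omega) (by omega) (by omega)
    refine h1.of_mul_right (Associated.prod _ _ _ fun k hk => (h2 k hk).pow_pow) ?_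
    refine Finset.prod_ne_zero_iff.2 fun k hk => pow_ne_zero _ fun h0 => ?_
    have := Finset.mem_Icc.1 hk
    exact hd k (by omega) (by omega) ((h2 k hk).eq_zero_iff.1 h0)

end SingularFactors

/-! ### Construction of the d_i and the final assembly. -/

section Main

theorem isUnit_of_isGCDOf_minors_zero {r c : Type*} {R : Type*} [CommRing R] {M : Matrix r c R}
    {x : R} (h : IsGCDOf (minors M 0) x) : IsUnit x :=
  isUnit_of_dvd_one (h.1 1 ⟨Function.Embedding.ofIsEmpty, Function.Embedding.ofIsEmpty,
    Matrix.det_isEmpty.symm⟩)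

theorem minorIdeal_eq_bot_iff {r c : Type*} {R : Type*} [CommRing R] {M : Matrix r c R} {k : ℕ}
    {x : R} (h : IsGCDOf (minors M k) x) : minorIdeal M k = ⊥ ↔ x = 0 := by
  rw [minorIdeal, Ideal.span_eq_bot]
  constructor
  · intro h0
    exact zero_dvd_iff.1 (h.2 0 fun y hy => (h0 y hy).symm ▸ dvd_rfl)
  · rintro rfl y hy
    exact zero_dvd_iff.1 (h.1 y hy)

theorem minorIdeal_antitone {r c : Type*} {R : Type*} [CommRing R] (M : Matrix r c R) :
    Antitone (minorIdeal M) :=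
  antitone_nat_of_succ_le (minorIdeal_succ_le M)

variable {n : ℕ} {φ : Fin 3 → Forms}

/-- The greatest common divisors of the minors of the Sylvester matrix determine a sequence of
singular factors. -/
theorem exists_singular_factors {μ : ℕ} {p q : Fin 3 → Forms} (hφ : IsProperParam n φ) (hn : 3 ≤ n)
    (hpq : IsMuBasis n φ μ p q) {G : ℕ → Forms}
    (hG : ∀ k, IsGCDOf (minors (psi n φ μ p q 0) k) (G k)) :
    ∃ d : ℕ → Forms, (∀ i, 1 ≤ i → i ≤ n → ∃ e, (d i).IsHomogeneous e) ∧
      (∀ i, 2 ≤ i → i ≤ n → d i ≠ 0) ∧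
      ∀ i, 1 ≤ i → i ≤ n →
        Associated (∏ k ∈ Finset.Icc i n, d k ^ (k - i + 1)) (G (n + 1 - i)) := by
  obtain ⟨hbot, hn0⟩ := hpq.minorIdeal_sylvester hφ hn
  have hne (k : ℕ) (hk : k < n) : G k ≠ 0 := fun h0 =>
    hbot (eq_bot_iff.2 ((minorIdeal_antitone _ (by omega : k ≤ n - 1)).trans
      ((minorIdeal_eq_bot_iff (hG k)).2 h0).le))
  have hGn : G n = 0 := (minorIdeal_eq_bot_iff (hG n)).1 hn0
  have hhom (k : ℕ) (hk : k < n) : ∃ e, (G k).IsHomogeneous e := by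
    obtain ⟨x, hx, hx0⟩ : ∃ x ∈ minors (psi n φ μ p q 0) k, x ≠ 0 := by
      by_contra! h
      exact hne k hk ((minorIdeal_eq_bot_iff (hG k)).1 (Ideal.span_eq_bot.2 h))
    obtain ⟨e, he⟩ := exists_isHomogeneous_of_mem_minors hφ hx
    exact isHomogeneous_of_dvd he hx0 ((hG k).1 x hx)
  obtain ⟨c, hc0, hc, hprod⟩ := exists_prod_eq_of_sq_dvd (n := n)
    (isUnit_of_isGCDOf_minors_zero (hG 0)) hne
    (sq_dvd_mul_of_isGCDOf_minors exists_prime_forms _ hG)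
  refine ⟨fun i => c (n - i), fun i h1 h2 => ?_, fun i h1 h2 => ?_, fun i h1 h2 => ?_⟩
  · obtain ⟨e₁, he₁⟩ := hhom 1 (by omega)
    change ∃ e, (c (n - i)).IsHomogeneous e
    rcases hk : n - i with _ | k
    · exact isHomogeneous_of_dvd he₁ (hne 1 (by omega)) hc0.dvd
    -- Here the index is i = 1: since `G n = 0`, the quotient is zero, so d_1 = 0. In the other case
    -- it divides a nonzero product of homogeneous gcds.
    · by_cases hk2 : k + 2 = n
      · have := hc k
        rw [hk2, hGn, zero_mul, eq_comm, mul_eq_zero] at this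
        rw [this.resolve_left (pow_ne_zero _ (hne _ (by omega)))]
        exact ⟨0, MvPolynomial.isHomogeneous_zero _ _ _⟩
      · obtain ⟨e₂, he₂⟩ := hhom (k + 2) (by omega)
        obtain ⟨e₃, he₃⟩ := hhom k (by omega)
        exact isHomogeneous_of_dvd (he₂.mul he₃)
          (mul_ne_zero (hne _ (by omega)) (hne _ (by omega))) (hc k ▸ dvd_mul_left _ _)
  · change c (n - i) ≠ 0
    rcases hk : n - i with _ | k
    · exact fun h0 => hne 1 (by omega) (hc0.eq_zero_iff.1 h0)
    · intro h0
      have := hc k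
      rw [h0, mul_zero] at this
      exact mul_ne_zero (hne _ (by omega)) (hne _ (by omega)) this
  · rw [prod_Icc_eq_prod_range _ h2]
    have : ∏ l ∈ Finset.range (n + 1 - i), c (n - (n - l)) ^ (n + 1 - i - l) =
        ∏ l ∈ Finset.range (n + 1 - i), c l ^ (n + 1 - i - l) := by
      refine Finset.prod_congr rfl fun l hl => ?_
      have := Finset.mem_range.1 hl
      rw [show n - (n - l) = l by omega]
    rw [this]
    exact (hprod _ (by omega)).symm

end Main

end HybridResultant

end

open HybridResultant in
theorem mainTheorem8 (n : ℕ) (hn : 3 ≤ n) (φ : Fin 3 → Forms) (hφ : IsProperParam n φ) :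
    ∃ d : ℕ → Forms,
      ∀ (μ : ℕ) (p q : Fin 3 → Forms), IsMuBasis n φ μ p q →
        (∀ i, n - μ < i → i ≤ n → IsUnit (d i)) ∧
        ∀ j, j ≤ μ → ∀ e : ℕ → Forms,
          IsSingularFactors (psi n φ μ p q j) e ↔
            ∀ i, 1 ≤ i → i ≤ n - j → Associated (e i) (d i) := by
  by_cases hex : ∃ (ν : ℕ) (p' q' : Fin 3 → Forms), IsMuBasis n φ ν p' q'
  swap
  · exact ⟨0, fun μ p q hpq => absurd ⟨μ, p, q, hpq⟩ hex⟩
  obtain ⟨ν, p', q', hpq'⟩ := hex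
  obtain ⟨G, hG⟩ := exists_isGCDOf_minors_psi hφ hn
  obtain ⟨d, hdhom, hd0, hdprod⟩ := exists_singular_factors hφ hn hpq'
    (hG ν p' q' hpq' 0 (Nat.zero_le _))
  refine ⟨d, fun μ p q hpq => ?_⟩
  have hle := hpq.le
  have hunit (i : ℕ) (h1 : n - μ < i) (h2 : i ≤ n) : IsUnit (d i) := by
    -- The index n + 1 - i is at most μ, so this is the gcd of the 0-minors of the matrix ψ_j with j
    -- = n + 1 - i.
    have hGu : IsUnit (G (n + 1 - i)) := by
      simpa using isUnit_of_isGCDOf_minors_zero (hG μ p q hpq (n + 1 - i) (by omega) 0)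
    have h3 := (hdprod i (by omega) h2).isUnit_iff.2 hGu
    refine isUnit_of_dvd_unit ?_ h3
    have := Finset.dvd_prod_of_mem (fun k => d k ^ (k - i + 1)) (Finset.left_mem_Icc.2 h2)
    simpa using this
  refine ⟨hunit, fun j hj e => ?_⟩
  have hN : μ + (n - μ) - j = n - j := by omega
  -- Truncating the product at n - j drops only factors of index greater than n - j ≥ n - μ, which
  -- are units.
  have hprod (i : ℕ) (h1 : 1 ≤ i) (h2 : i ≤ n - j) :
      Associated (∏ k ∈ Finset.Icc i (n - j), d k ^ (k - i + 1)) (G (n + 1 - i)) := by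
    refine Associated.trans ?_ (hdprod i h1 (by omega))
    have hsub : Finset.Icc i (n - j) ⊆ Finset.Icc i n := Finset.Icc_subset_Icc_right (by omega)
    rw [← Finset.prod_sdiff hsub]
    refine (associated_unit_mul_left _ _ (Finset.prod_induction _ IsUnit (fun _ _ => IsUnit.mul)
      isUnit_one fun k hk => ?_)).symm
    simp only [Finset.mem_sdiff, Finset.mem_Icc] at hk
    exact (hunit k (by omega) (by omega)).pow _
  have hgcd (i : ℕ) (h1 : 1 ≤ i) (h2 : i ≤ n - j) (x : Forms) :
      IsGCDOf (minors (psi n φ μ p q j) (μ + (n - μ) - j + 1 - i)) x ↔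
        Associated x (G (n + 1 - i)) := by
    have h3 := hG μ p q hpq j hj (μ + (n - μ) - j + 1 - i)
    rw [show μ + (n - μ) - j + 1 - i + j = n + 1 - i by omega] at h3
    exact ⟨fun h => h.associated h3, fun h => h3.congr h.symm⟩
  constructor
  · intro he
    refine associated_of_prod_Icc_associated (fun i h1 h2 => hd0 i h1 (by omega)) fun i h1 h2 => ?_
    have h3 := (hgcd i h1 h2 _).1 (he i h1 (by omega)).2
    rw [hN] at h3
    exact h3.trans (hprod i h1 h2).symm
  · intro he i h1 h2
    rw [hN] at h2
    constructor
    · by_cases h0 : d i = 0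
      · rw [(he i h1 h2).eq_zero_iff.2 h0]
        exact ⟨0, MvPolynomial.isHomogeneous_zero _ _ _⟩
      · obtain ⟨k, hk⟩ := hdhom i h1 (by omega)
        exact isHomogeneous_of_dvd hk h0 (he i h1 h2).dvd
    · rw [hgcd i h1 h2, hN]
      refine Associated.trans (Associated.prod _ _ _ fun k hk => ?_) (hprod i h1 h2)
      have := Finset.mem_Icc.1 hk
      exact (he k (by omega) (by omega)).pow_pow
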